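/- **Definitions.** A *PO system* is a set $P$ with a transitive antisymmetric relation $<$; $p\leqslant q$ means $p<q$ or $p=q$, $p\lneqq q$ means $p\leqslant q$ and $p\ne q$, and $P^d=\{p\mid p\not<p\}$. Suprema, ideals (non-empty, downward closed, upward directed subsets) and "strictly increasing" refer to the partial order $\leqslant$. $\mathrm{id}(P)$ is the set of ideals of $P$ ordered by inclusion, made a PO system by $\mathrm{id}(P)^d=\{p_\downarrow\mid p\in P^d\}$, where $p_\downarrow=\{p'\mid p'\leqslant p\}$; $P$ is identified with the set of principal ideals $p_\downarrow$. An element of $P$ is *separated* if it is not the supremum of a strictly increasing sequence. A map $\alpha\colon Q\to P$ of PO systems is a *morphism* if $\alpha(\{r\mid r>q\})=\{p\mid p>\alpha(q)\}$ for all $q\in Q$. An *$\omega$-Stone space* $W$ is a second countable, locally compact, totally disconnected Hausdorff space (equivalently, the Stone space of a countable Boolean ring). A compact open $A\subseteq W$ is *pseudo-indecomposable* if for every compact open $B\subseteq A$ the Boolean ring of compact open subsets of $B$, or that of $A\setminus B$, is isomorphic to that of $A$; $W$ is *primitive* if every compact open set is a disjoint union of finitely many pseudo-indecomposable ones. A *$P$-partition*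 $\mathscr X=\{X_p\mid p\in P\}^*$ of $W$ consists of non-empty pairwise disjoint sets $X_p\subseteq W$ such that, with $X=\bigcup_pX_p$ and $'$ denoting the derived set, $X_p'\cap X=\bigcup_{q<p}X_q$ for all $p$. It is *complete* if $X=W$. For $A\subseteq W$ let $T_{\mathscr X}(A)=\{p\mid A\cap X_p\neq\emptyset\}$. A compact open $A$ is *$p$-trim* if $T_{\mathscr X}(A)=\{q\mid q\geqslant p\}$ and, if $p\in P^d$, $|A\cap X_p|=1$. Let $\widehat P$ be the set of $p$ for which a $p$-trim set exists, and for $w\in W$ let $I_w=\{p\mid w\text{ lies in some }p\text{-trim set}\}$. A point is *clean* if for some $p$ it lies in $X_p$ and in a $p$-trim set. Consider the axioms: (T1) every point of $W$ has a neighbourhood base of trim sets; (T2) for $p\in\widehat P$, every point with a neighbourhood base of $p$-trim sets lies in $X_p$; (T3) all points of $X$ are clean; (ST3) clean points are dense in $X_p$ for $p\in\widehat P$. A $P$-partition is *trim* if it satisfies T1, T2, T3, and *semi-trim* if it satisfies T1, T2, ST3. The *clean interior* $\mathscr X^o$ of a semi-trim partition is $\{Z_p\mid p\in\widehat P\}^*$,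 where $Z_p$ is the set of clean points of $X_p$. A *rank $P$-partition* is a complete $P$-partition such that, writing $\tau(w)=p$ for $w\in X_p$: (RP1) if $q$ is separated, $x=\lim x_k$, $\tau(x)\geqslant q$ and the sequence $(\tau(x_k))_k$ is either pairwise incomparable or strictly increasing, then $\tau(x_k)\geqslant q$ for almost all $k$; (RP2) if $\tau(x)$ is not separated, then $x=\lim x_k$ for some sequence with $\tau(x_k)\lneqq\tau(x)$ for all $k$. If $\mathscr Y=\{Y_q\mid q\in Q\}^*$ is a $Q$-partition and $\mathscr Z=\{Z_p\mid p\in P\}^*$ a $P$-partition of $W$, both satisfying T1, and $\alpha\colon Q\to P$ is a map, then $\mathscr Y\prec_\alpha\mathscr Z$ ($\mathscr Y$ *regularly refines* $\mathscr Z$ via $\alpha$) means that $Y_q\subseteq Z_{\alpha(q)}$ for all $q\in Q$, and $p\in\alpha(T_{\mathscr Y}(A))$ for every $p\in\widehat P$ and every $p$-trim set $A$ of $\mathscr Z$. If $Q\subseteq P$ as PO systems, a $P$-partition $\mathscr X$ *regularly extends* a semi-trim $Q$-partition $\mathscr Y$ if $Y_q\subseteq X_q$ for all $q\in Q$ and,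 for every compact open $A$ and $p\in T_{\mathscr X}(A)$, there is $q\in T_{\mathscr Y}(A)$ with $q\leqslant p$. For a trim $P$-partition $\mathscr Y=\{Y_p\mid p\in P\}^*$ of $W$, the *ideal completion* is $\mathrm{id}(\mathscr Y)=\{Y(J)\mid J\in\mathrm{id}(P)\}$, where $Y(J)=\{w\in W\mid I_w=J\}$. A *$P$-homeomorphism* of $W$ is a homeomorphism $h\colon W\to W$ with $h(Y_p)=Y_p$ for all $p\in P$. **Theorem (Ideal completions).** Let $W$ be a primitive $\omega$-Stone space, $P$ a PO system and $\mathscr Y$ a trim $P$-partition of $W$. Then $\mathrm{id}(\mathscr Y)$ is a rank $\mathrm{id}(P)$-partition of $W$. Moreover: 1. $\mathrm{id}(\mathscr Y)$ is semi-trim and $(\mathrm{id}(\mathscr Y))^o=\mathscr Y$ (identifying $P$ with the principal ideals); 2. $\mathrm{id}(\mathscr Y)$ regularly extends $\mathscr Y$; 3. the elements of $\mathrm{id}(\mathscr Y)$ are the orbits in $W$ of the $P$-homeomorphisms of $W$; 4. if $\mathscr V$ is a complete semi-trim $Q$-partition of $W$, for a PO system $Q$, such that $\mathscr V^o=\mathscr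 Y$ (so that $\widehat Q=P$), then every ideal $J$ of $P$ has a supremum in $Q$, and $\mathrm{id}(\mathscr Y)\prec_\beta\mathscr V$, where $\beta(J)=\sup_QJ$ for $J\in\mathrm{id}(P)$; 5. if $Q$ is a PO system, $\mathscr V$ a trim $Q$-partition of $W$ and $\alpha\colon Q\to P$ a surjective morphism such that $\mathscr V\prec_\alpha\mathscr Y$, then $\mathrm{id}(\mathscr V)\prec_{\mathrm{id}(\alpha)}\mathrm{id}(\mathscr Y)$, where $\mathrm{id}(\alpha)\colon\mathrm{id}(Q)\to\mathrm{id}(P)$ is the map $\mathrm{id}(\alpha)(J)=\{p\in P\mid p\leqslant\alpha(q)\text{ for some }q\in J\}$. -/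

import Mathlib

open Set Filter Topology TopologicalSpace

namespace PrimitiveSpace

/-- A PO system, presented as a poset with a distinguished subset `selfRel`, the set of those `p`
with `p ≺ p`.  The associated relation is `PrimitiveSpace.prec`. -/
class POSystem (P : Type*) extends PartialOrder P where
  /-- The elements that are related to themselves. -/
  selfRel : Set P

/-- The antisymmetric transitive relation of a PO system, written `p < q` in the literature. Beware
that Lean's `p < q` on a PO system means `p ≤ q` and `p ≠ q`. -/
def prec {P : Type*} [POSystem P] (p q : P) : Prop :=
  p < q ∨ (p = q ∧ p ∈ POSystem.selfRel (P := P))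

/-- `P^d`, the set of elements of `P` that are not related to themselves. -/
def discreteElts (P : Type*) [POSystem P] : Set P := {p | ¬ prec p p}

theorem prec_self_iff {P : Type*} [POSystem P] (p : P) :
    prec p p ↔ p ∈ POSystem.selfRel (P := P) := by
  simp [prec]

theorem prec_trans {P : Type*} [POSystem P] {p q r : P} (h : prec p q) (h' : prec q r) :
    prec p r := by
  rcases h with h | ⟨rfl, h⟩
  · rcases h' with h' | ⟨rfl, h'⟩
    · exact Or.inl (h.trans h')
    · exact Or.inl h
  · exact h'

theorem prec_antisymm {P : Type*} [POSystem P] {p q : P} (h : prec p q) (h' : prec q p) :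
    p = q := by
  rcases h with h | ⟨h, _⟩
  · rcases h' with h' | ⟨h', _⟩
    · exact absurd h' h.asymm
    · exact h'.symm
  · exact h

theorem le_iff_prec_or_eq {P : Type*} [POSystem P] {p q : P} : p ≤ q ↔ prec p q ∨ p = q := by
  constructor
  · intro h
    rcases h.lt_or_eq with h | h
    · exact Or.inl (Or.inl h)
    · exact Or.inr h
  · rintro ((h | ⟨h, _⟩) | h)
    · exact h.le
    · exact h.le
    · exact h.le

/-- A subset of a PO system with the restricted relation. -/
instance subsetPOSystem {P : Type*} [POSystem P] (S : Set P) : POSystem S where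
  selfRel := {p | (p : P) ∈ POSystem.selfRel (P := P)}

theorem prec_coe_iff {P : Type*} [POSystem P] {S : Set P} (p q : S) :
    prec (p : P) (q : P) ↔ prec p q := by
  simp only [prec, Subtype.coe_lt_coe, Subtype.coe_inj]
  rfl

/-- The ideal completion `id(P)`: the (non-empty) ideals of `P` ordered by inclusion, where the
elements not related to themselves are the principal ideals `{p' | p' ≤ p}` with `p ∈ P^d`. -/
instance idealPOSystem {P : Type*} [POSystem P] : POSystem (Order.Ideal P) where
  selfRel := (Order.Ideal.principal '' discreteElts P)ᶜ

theorem discreteElts_ideal (P : Type*) [POSystem P] :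
    discreteElts (Order.Ideal P) = Order.Ideal.principal '' discreteElts P := by
  ext J
  change ¬ prec J J ↔ _
  rw [prec_self_iff]
  exact not_not

/-- A morphism of PO systems: `{r | r > q} α = {p | p > q α}` for all `q`, where `<` is the relation
of the PO system. -/
def IsMorphism {Q P : Type*} [POSystem Q] [POSystem P] (α : Q → P) : Prop :=
  ∀ q, α '' {r | prec q r} = {p | prec (α q) p}

/-- `p` is separated: it is not the supremum of a strictly increasing sequence. -/
def IsSeparated {P : Type*} [POSystem P] (p : P) : Prop :=
  ¬ ∃ s : ℕ → P, StrictMono s ∧ IsLUB (range s) p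

section Primitive

variable {W : Type*} [TopologicalSpace W] [T2Space W]

/-- The ideals `(A)` and `(B)` of the Boolean ring of compact open subsets of `W` (with symmetric
difference as addition and intersection as multiplication) are isomorphic as Boolean rings. -/
def IdealIso (A B : CompactOpens W) : Prop :=
  ∃ f : CompactOpens W → CompactOpens W, BijOn f (Iic A) (Iic B) ∧
    ∀ C ∈ Iic A, ∀ D ∈ Iic A,
      f (symmDiff C D) = symmDiff (f C) (f D) ∧ f (C ⊓ D) = f C ⊓ f D

/-- `A` is pseudo-indecomposable. -/
def IsPI (A : CompactOpens W) : Prop :=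
  ∀ B ≤ A, IdealIso B A ∨ IdealIso (A \ B) A

variable (W) in
/-- `W` is primitive: every compact open set is a disjoint union of finitely many
pseudo-indecomposable ones. -/
def IsPrimitive : Prop :=
  ∀ A : CompactOpens W, ∃ s : Finset (CompactOpens W),
    (∀ B ∈ s, IsPI B) ∧ (s : Set (CompactOpens W)).PairwiseDisjoint id ∧ s.sup id = A

end Primitive

section Partitions

variable {W : Type*} [TopologicalSpace W] {P Q : Type*} [POSystem P] [POSystem Q]

/-- The family `X` is a `P`-partition of `W`: the sets `X p` are non-empty and disjoint and
`(X p)' ∩ ⋃ q, X q = ⋃ q ≺ p, X q`.  (The sets `X p` need not cover `W`; the remainder is a further,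
possibly empty, element of the partition.) -/
structure IsPPartition (X : P → Set W) : Prop where
  nonempty : ∀ p, (X p).Nonempty
  disjoint : Pairwise fun p q => Disjoint (X p) (X q)
  derived : ∀ p, derivedSet (X p) ∩ (⋃ q, X q) = ⋃ q ∈ {q | prec q p}, X q

/-- The family `X` covers `W`. -/
def IsCompletePartition (X : P → Set W) : Prop := ⋃ p, X p = univ

/-- The type `T(A)` of a subset `A`. -/
def typeOf (X : P → Set W) (A : Set W) : Set P := {p | (A ∩ X p).Nonempty}

/-- `A` is a `p`-trim set. -/
structure IsTrim (X : P → Set W) (p : P) (A : Set W) : Prop where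
  isCompact : IsCompact A
  isOpen : IsOpen A
  type_eq : typeOf X A = Ici p
  card_eq : p ∈ discreteElts P → (A ∩ X p).encard = 1

/-- `P̂`, the set of types of trim sets. -/
def trimTypes (X : P → Set W) : Set P := {p | ∃ A, IsTrim X p A}

/-- `I_w`, the set of types of the trim neighbourhoods of `w`. -/
def trimIdeal (X : P → Set W) (w : W) : Set P := {p | ∃ A, IsTrim X p A ∧ w ∈ A}

/-- `w` lies in some `X p` and has a `p`-trim neighbourhood. -/
def IsClean (X : P → Set W) (w : W) : Prop := ∃ p, w ∈ X p ∧ ∃ A, IsTrim X p A ∧ w ∈ A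

/-- Axiom T1: every point has a neighbourhood base of trim sets. -/
def HasTrimBase (X : P → Set W) : Prop :=
  ∀ w, ∀ U ∈ 𝓝 w, ∃ p A, IsTrim X p A ∧ w ∈ A ∧ A ⊆ U

/-- Axiom T2: a point with a neighbourhood base of `p`-trim sets lies in `X p`. -/
def IsFull (X : P → Set W) : Prop :=
  ∀ p ∈ trimTypes X, ∀ w, (∀ U ∈ 𝓝 w, ∃ A, IsTrim X p A ∧ w ∈ A ∧ A ⊆ U) → w ∈ X p

/-- Trim `P`-partitions (axioms T1, T2 and T3). -/
structure IsTrimPartition (X : P → Set W) : Prop extends IsPPartition X where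
  trimBase : HasTrimBase X
  full : IsFull X
  clean : ∀ p, ∀ w ∈ X p, IsClean X w

/-- Semi-trim `P`-partitions: clean points are dense in `X p` for each `p ∈ P̂`. -/
structure IsSemiTrimPartition (X : P → Set W) : Prop extends IsPPartition X where
  trimBase : HasTrimBase X
  full : IsFull X
  clean_dense : ∀ p ∈ trimTypes X, X p ⊆ closure {w ∈ X p | IsClean X w}

/-- The clean interior of a (semi-trim) partition, a family indexed by the PO system `P̂`. -/
def cleanInterior (X : P → Set W) : trimTypes X → Set W :=
  fun p => {w ∈ X p | IsClean X w}

/-- The families `X` and `Y` are the same partition, when the PO systems `P` and `Q` are identified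
via the isomorphism `e`. -/
structure SamePartition (X : P → Set W) (Y : Q → Set W) (e : P ≃ Q) : Prop where
  prec_iff : ∀ p p', prec (e p) (e p') ↔ prec p p'
  part_eq : ∀ p, Y (e p) = X p

/-- Rank `P`-partitions.  For the label function `τ` of the complete partition `X`, the relation
`τ x = p` is expressed as `x ∈ X p`. -/
structure IsRankPartition (X : P → Set W) : Prop extends IsPPartition X where
  complete : IsCompletePartition X
  rp1 : ∀ q : P, IsSeparated q → ∀ (x : W) (p : P), x ∈ X p → q ≤ p →
    ∀ (xs : ℕ → W) (ps : ℕ → P), (∀ k, xs k ∈ X (ps k)) → Tendsto xs atTop (𝓝 x) →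
    ((Pairwise fun j k => ¬ ps j ≤ ps k) ∨ StrictMono ps) → ∀ᶠ k in atTop, q ≤ ps k
  rp2 : ∀ (x : W) (p : P), x ∈ X p → ¬ IsSeparated p →
    ∃ (xs : ℕ → W) (ps : ℕ → P), (∀ k, xs k ∈ X (ps k)) ∧ Tendsto xs atTop (𝓝 x) ∧
      ∀ k, ps k < p

/-- The ideal completion `id(X)` of a trim `P`-partition `X`. -/
def idealCompletion (X : P → Set W) : Order.Ideal P → Set W :=
  fun J => {w | trimIdeal X w = (J : Set P)}

/-- `Y ≺_α Z`: the `Q`-partition `Y` regularly refines the `P`-partition `Z` via `α`. -/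
structure RegularlyRefines (Y : Q → Set W) (Z : P → Set W) (α : Q → P) : Prop where
  source : IsPPartition Y
  target : IsPPartition Z
  refines : ∀ q, Y q ⊆ Z (α q)
  source_trimBase : HasTrimBase Y
  target_trimBase : HasTrimBase Z
  regular : ∀ p ∈ trimTypes Z, ∀ A, IsTrim Z p A → p ∈ α '' typeOf Y A

/-- The `P`-partition `X` is a regular extension of the semi-trim `Q`-partition `Y`, where the PO
system `Q` is identified with a subset of the PO system `P` via `ι`. -/
structure IsRegularExtension (X : P → Set W) (Y : Q → Set W) (ι : Q → P) : Prop where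
  injective : Function.Injective ι
  prec_iff : ∀ q q', prec (ι q) (ι q') ↔ prec q q'
  isPPartition : IsPPartition X
  semiTrim : IsSemiTrimPartition Y
  part_subset : ∀ q, Y q ⊆ X (ι q)
  regular : ∀ A : Set W, IsCompact A → IsOpen A → ∀ p ∈ typeOf X A, ∃ q ∈ typeOf Y A, ι q ≤ p

/-- `h` is a `P`-homeomorphism of `W` onto itself, with respect to the partition `X`. -/
def IsPHomeo (X : P → Set W) (h : W ≃ₜ W) : Prop := ∀ p, h '' X p = X p

/-- The orbits in `W` under the `P`-homeomorphisms of `W`. -/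
def pHomeoOrbits (X : P → Set W) : Set (Set W) :=
  {O | ∃ w, O = {v | ∃ h : W ≃ₜ W, IsPHomeo X h ∧ h w = v}}

end Partitions

end PrimitiveSpace

open PrimitiveSpace

open PrimitiveSpace

namespace PrimitiveSpace

/-! ### Order relations in PO systems and principal ideals. -/

section POSystem

variable {P : Type*} [POSystem P] {p q r : P}

/-! For a trim partition the types of the trim neighbourhoods of a point `w` form an ideal `I_w`,
and `w` lies in `Y p` exactly when `I_w` is the principal ideal of `p`. The decisive fact is the
converse, `exists_mem_idealCompletion_of_isTrim`: every ideal `J` containing `p` equals `I_w` for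
some `w` in any given `p`-trim set. It is a generic-filter argument: the trim sets are shrunk so
that their types become cofinal in `J` while every one of the countably many compact open sets is
decided, and compactness supplies the point. Hence an open set meets `Y(J)` iff it meets `Y p` for
some `p ∈ J`, which reduces derived sets, trim sets and regularity of the completion to those of
`Y`. The rank axioms follow because `P` is countable, so that the separated ideals are exactly the
principal ones.

In a complete semi-trim partition with clean interior `Y`, the label of a point of `Y(J)` is forced
to be the supremum of `J`: its trim neighbourhoods give upper bounds, and the derived-set condition
gives minimality.

The orbit statement is a back-and-forth argument. Points `w`, `v` with `I_w = I_v` have disjoint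
trim neighbourhoods of equal type. Any partition of one into trim sets can be copied in the other
with `w` and `v` in corresponding pieces (`exists_matching_of_mem`). A generic sequence of finer and
finer such matchings defines an involution that sends `w` to `v` and preserves each `Y p` by T2. -/

theorem mem_discreteElts_iff : p ∈ discreteElts P ↔ p ∉ POSystem.selfRel (P := P) := by
  rw [← prec_self_iff]; rfl

theorem prec.le (h : prec p q) : p ≤ q := le_iff_prec_or_eq.2 (Or.inl h)

theorem prec_of_lt (h : p < q) : prec p q := Or.inl h

theorem prec_of_le_of_notMem_discreteElts (h : p ≤ q) (hp : p ∉ discreteElts P) : prec p q := by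
  rcases h.lt_or_eq with h | rfl
  · exact Or.inl h
  · exact not_not.1 hp

theorem prec_principal_iff :
    prec (Order.Ideal.principal p) (Order.Ideal.principal q) ↔ prec p q := by
  have hinj : ∀ {p q : P}, Order.Ideal.principal p = Order.Ideal.principal q ↔ p = q := by
    intro p q
    simp [le_antisymm_iff]
  have hself : Order.Ideal.principal p ∈ POSystem.selfRel (P := Order.Ideal P) ↔
      p ∈ POSystem.selfRel (P := P) := by
    change ¬ (∃ x, x ∈ discreteElts P ∧ _) ↔ _
    simp [hinj, mem_discreteElts_iff]
  simp only [prec, hinj, hself, lt_iff_le_not_ge, Order.Ideal.principal_le_iff,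
    Order.Ideal.mem_principal]

theorem principal_injective :
    Function.Injective (Order.Ideal.principal : P → Order.Ideal P) := fun _ _ h =>
  le_antisymm (Order.Ideal.principal_le_iff.1 h.le) (Order.Ideal.principal_le_iff.1 h.ge)

end POSystem

theorem typeOf_mono {W P : Type*} {X : P → Set W} {A B : Set W} (h : A ⊆ B) :
    typeOf X A ⊆ typeOf X B := fun _ hp =>
  hp.mono (inter_subset_inter_left _ h)

/-! ### Trim sets and the ideal of types at a point. -/

section Trim

variable {W : Type*} [TopologicalSpace W] {P : Type*} [POSystem P] {X Y : P → Set W}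
  {p q r : P} {A B C : Set W} {v w : W} {U : Set W}

theorem IsTrim.mem_typeOf_iff (h : IsTrim X p A) : q ∈ typeOf X A ↔ p ≤ q := by
  rw [h.type_eq]; rfl

theorem IsTrim.le (h : IsTrim X p A) (hA : w ∈ A) (hX : w ∈ X q) : p ≤ q :=
  h.mem_typeOf_iff.1 ⟨w, hA, hX⟩

theorem IsTrim.self_mem_typeOf (h : IsTrim X p A) : p ∈ typeOf X A :=
  h.mem_typeOf_iff.2 le_rfl

theorem IsTrim.mem_nhds (h : IsTrim X p A) (hA : w ∈ A) : A ∈ 𝓝 w := h.isOpen.mem_nhds hA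

theorem IsTrim.eq_of_mem (h : IsTrim X p A) (hp : p ∈ discreteElts P) (hw : w ∈ A ∩ X p)
    (hv : v ∈ A ∩ X p) : w = v := by
  obtain ⟨x, hx⟩ := encard_eq_one.1 (h.card_eq hp)
  rw [hx] at hw hv
  exact hw.trans hv.symm

theorem isTrim_of (hc : IsCompact A) (ho : IsOpen A) (ht : ∀ q, q ∈ typeOf X A ↔ p ≤ q)
    (hs : p ∈ discreteElts P → ∀ w ∈ A ∩ X p, ∀ v ∈ A ∩ X p, w = v) : IsTrim X p A where
  isCompact := hc
  isOpen := ho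
  type_eq := Set.ext ht
  card_eq hp := by
    obtain ⟨w, hw⟩ := (ht p).2 le_rfl
    exact encard_eq_one.2 ⟨w, eq_singleton_iff_unique_mem.2 ⟨hw, fun v hv => hs hp v hv w hw⟩⟩

/-- Gluing on a set of larger type changes nothing, unless `p` is discrete and a second point of `X
p` comes in. This is how a trim set is extended to reach a prescribed point. -/
theorem IsTrim.union (hA : IsTrim X p A) (hB : IsTrim X q B) (hpq : p ≤ q)
    (h : p ∈ discreteElts P → B ∩ X p ⊆ A) : IsTrim X p (A ∪ B) := by
  refine isTrim_of (hA.isCompact.union hB.isCompact) (hA.isOpen.union hB.isOpen) (fun r => ?_) ?_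
  · constructor
    · rintro ⟨w, hw | hw, hr⟩
      · exact hA.le hw hr
      · exact hpq.trans (hB.le hw hr)
    · exact fun hr => typeOf_mono subset_union_left (hA.mem_typeOf_iff.2 hr)
  · intro hp w hw v hv
    have key : ∀ w ∈ (A ∪ B) ∩ X p, w ∈ A ∩ X p := fun w hw =>
      ⟨hw.1.elim id fun hB => h hp ⟨hB, hw.2⟩, hw.2⟩
    exact hA.eq_of_mem hp (key w hw) (key v hv)

namespace IsTrimPartition

variable (hY : IsTrimPartition Y)
include hY

theorem eq_of_mem (hp : w ∈ Y p) (hq : w ∈ Y q) : p = q := by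
  by_contra h
  exact disjoint_left.1 (hY.disjoint h) hp hq

theorem exists_isTrim_subset (hw : w ∈ Y p) (hU : U ∈ 𝓝 w) :
    ∃ A, IsTrim Y p A ∧ w ∈ A ∧ A ⊆ U := by
  obtain ⟨q, hq, B, hB, hwB⟩ := hY.clean p w hw
  obtain rfl := hY.eq_of_mem hw hq
  obtain ⟨r, A, hA, hwA, hAU⟩ := hY.trimBase w (U ∩ B) (inter_mem hU (hB.mem_nhds hwB))
  have h1 : r ≤ p := hA.le hwA hw
  have h2 : p ≤ r := hB.mem_typeOf_iff.1
    (typeOf_mono (hAU.trans inter_subset_right) hA.self_mem_typeOf)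
  obtain rfl := le_antisymm h1 h2
  exact ⟨A, hA, hwA, hAU.trans inter_subset_left⟩

/-- A point of `C ∩ Y p` has a `p`-trim neighbourhood inside `C`, which already realizes every type
above `p`. -/
theorem isTrim_of_subset (hA : IsTrim Y p A) (hCA : C ⊆ A) (hc : IsCompact C) (ho : IsOpen C)
    (hp : p ∈ typeOf Y C) : IsTrim Y p C := by
  refine isTrim_of hc ho (fun q => ⟨fun hq => hA.mem_typeOf_iff.1 (typeOf_mono hCA hq), ?_⟩) ?_
  · intro hq
    obtain ⟨x, hxC, hx⟩ := hp
    obtain ⟨D, hD, -, hDC⟩ := hY.exists_isTrim_subset hx (ho.mem_nhds hxC)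
    exact typeOf_mono hDC (hD.mem_typeOf_iff.2 hq)
  · intro hp w hw v hv
    exact hA.eq_of_mem hp ⟨hCA hw.1, hw.2⟩ ⟨hCA hv.1, hv.2⟩

theorem exists_isTrim (p : P) : ∃ A, IsTrim Y p A := by
  obtain ⟨x, hx⟩ := hY.nonempty p
  obtain ⟨A, hA, -⟩ := hY.exists_isTrim_subset hx univ_mem
  exact ⟨A, hA⟩

theorem trimTypes_eq : trimTypes Y = univ := eq_univ_of_forall hY.exists_isTrim

theorem exists_ne_of_prec (hx : w ∈ Y p) (hpq : prec p q) (hU : U ∈ 𝓝 w) :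
    ∃ x ∈ U ∩ Y q, x ≠ w := by
  have : w ∈ derivedSet (Y q) ∩ ⋃ q, Y q := by
    rw [hY.derived]
    exact mem_biUnion (show p ∈ {p | prec p q} from hpq) hx
  exact accPt_iff_nhds.1 this.1 U hU

theorem isSemiTrimPartition : IsSemiTrimPartition Y where
  toIsPPartition := hY.toIsPPartition
  trimBase := hY.trimBase
  full := hY.full
  clean_dense p _ := fun _ hw => subset_closure ⟨hw, hY.clean p _ hw⟩

theorem mem_of_trimIdeal_eq (hw : trimIdeal Y w = Iic p) : w ∈ Y p := by
  refine hY.full p (hY.trimTypes_eq ▸ mem_univ p) w fun U hU => ?_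
  obtain ⟨A, hA, hwA⟩ : p ∈ trimIdeal Y w := hw ▸ mem_Iic.2 le_rfl
  obtain ⟨r, C, hC, hwC, hCU⟩ := hY.trimBase w (A ∩ U) (inter_mem (hA.mem_nhds hwA) hU)
  have h1 : r ≤ p := by
    have : r ∈ trimIdeal Y w := ⟨C, hC, hwC⟩
    rwa [hw] at this
  have h2 := hA.mem_typeOf_iff.1 (typeOf_mono (hCU.trans inter_subset_left) hC.self_mem_typeOf)
  obtain rfl := le_antisymm h1 h2
  exact ⟨C, hC, hwC, hCU.trans inter_subset_right⟩

variable [T2Space W]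

/-- If `p` is the type of some trim neighbourhood of `w`, then inside a neighbourhood of `w` that
meets `Y p` there is a `p`-trim neighbourhood of `w`. -/
theorem exists_isTrim_subset_of_mem_trimIdeal (hp : p ∈ trimIdeal Y w) (ho : IsOpen B)
    (hw : w ∈ B) (hpB : p ∈ typeOf Y B) : ∃ A, IsTrim Y p A ∧ w ∈ A ∧ A ⊆ B := by
  obtain ⟨x, hxB, hx⟩ := hpB
  by_cases hwx : w = x
  · subst hwx
    exact hY.exists_isTrim_subset hx (ho.mem_nhds hxB)
  obtain ⟨E, hE, hwE⟩ := hp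
  -- A small trim neighbourhood of `w` has type at least `p` because it lies in `E`. If its type is
  -- larger, a `p`-trim neighbourhood of `x` disjoint from it is glued on.
  obtain ⟨r, A, hA, hwA, hAU⟩ := hY.trimBase w (B ∩ E ∩ {x}ᶜ)
    (inter_mem (inter_mem (ho.mem_nhds hw) (hE.mem_nhds hwE)) (isOpen_ne.mem_nhds hwx))
  have hpr : p ≤ r := hE.mem_typeOf_iff.1
    (typeOf_mono (fun y hy => (hAU hy).1.2) hA.self_mem_typeOf)
  rcases hpr.eq_or_lt with rfl | hpr
  · exact ⟨A, hA, hwA, fun y hy => (hAU hy).1.1⟩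
  obtain ⟨D, hD, hxD, hDB⟩ := hY.exists_isTrim_subset hx
    ((ho.inter hA.isCompact.isClosed.isOpen_compl).mem_nhds
      ⟨hxB, fun hxA => (hAU hxA).2 rfl⟩)
  refine ⟨D ∪ A, hD.union hA hpr.le fun _ y hy => ?_, Or.inr hwA,
    union_subset (hDB.trans inter_subset_left) fun y hy => (hAU hy).1.1⟩
  exact absurd (hA.le hy.1 hy.2) hpr.not_ge

/-- Downward closure is by gluing: for `q < p`, a `p`-trim neighbourhood misses `Y q`, so a `q`-trim
set disjoint from it can be added. Directedness comes from T1, since a smaller trim set has a larger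
type. -/
theorem isIdeal_trimIdeal (w : W) : Order.IsIdeal (trimIdeal Y w) := by
  refine ⟨?_, ?_, ?_⟩
  · rintro p q hqp ⟨A, hA, hw⟩
    rcases hqp.eq_or_lt with rfl | hqp
    · exact ⟨A, hA, hw⟩
    obtain ⟨x, hx⟩ := hY.nonempty q
    have hxA : x ∉ A := fun h => hqp.not_ge (hA.le h hx)
    obtain ⟨B, hB, -, hBA⟩ := hY.exists_isTrim_subset hx
      (hA.isCompact.isClosed.isOpen_compl.mem_nhds hxA)
    exact ⟨B ∪ A, hB.union hA hqp.le fun _ y hy => absurd (hA.le hy.1 hy.2) hqp.not_ge, Or.inr hw⟩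
  · obtain ⟨p, A, hA, hw, -⟩ := hY.trimBase w univ univ_mem
    exact ⟨p, A, hA, hw⟩
  · rintro p ⟨A, hA, hwA⟩ q ⟨B, hB, hwB⟩
    obtain ⟨r, C, hC, hwC, hCU⟩ := hY.trimBase w (A ∩ B)
      (inter_mem (hA.mem_nhds hwA) (hB.mem_nhds hwB))
    exact ⟨r, ⟨C, hC, hwC⟩,
      hA.mem_typeOf_iff.1 (typeOf_mono (hCU.trans inter_subset_left) hC.self_mem_typeOf),
      hB.mem_typeOf_iff.1 (typeOf_mono (hCU.trans inter_subset_right) hC.self_mem_typeOf)⟩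

theorem trimIdeal_eq_of_mem (hw : w ∈ Y p) : trimIdeal Y w = Iic p := by
  refine Subset.antisymm (fun q ⟨A, hA, hwA⟩ => hA.le hwA hw) fun q hq => ?_
  obtain ⟨A, hA, hwA, -⟩ := hY.exists_isTrim_subset hw univ_mem
  exact (hY.isIdeal_trimIdeal w).IsLowerSet hq ⟨A, hA, hwA⟩

end IsTrimPartition

end Trim

theorem countable_isCompact_isOpen (W : Type*) [TopologicalSpace W] [SecondCountableTopology W] :
    {A : Set W | IsCompact A ∧ IsOpen A}.Countable := by
  have hb := isBasis_countableBasis W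
  refine ((countable_ofPred_finite_subset (countable_countableBasis W)).image
    sUnion).mono ?_
  rintro A ⟨hc, ho⟩
  obtain ⟨S, hS, rfl⟩ := hb.open_eq_sUnion ho
  obtain ⟨T, hTS, hT, hST⟩ := hc.elim_finite_subcover_image (b := S) (c := id)
    (fun s hs => hb.isOpen (hS hs)) (by rw [sUnion_eq_biUnion]; rfl)
  refine ⟨T, ⟨hT, hTS.trans hS⟩, Subset.antisymm (sUnion_mono hTS) ?_⟩
  rwa [sUnion_eq_biUnion (s := T)]

/-! ### Realizing ideals by points; separated ideals. -/

section IdealCompletion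

variable {W : Type*} [TopologicalSpace W] {P : Type*} [POSystem P] {Y : P → Set W}
  {p q r : P} {A B C : Set W} {v w : W} {U : Set W} {J : Order.Ideal P}

theorem mem_idealCompletion : w ∈ idealCompletion Y J ↔ trimIdeal Y w = J := Iff.rfl

theorem IsTrim.mem_of_mem_idealCompletion (hA : IsTrim Y p A) (hw : w ∈ A)
    (hJ : w ∈ idealCompletion Y J) : p ∈ J := by
  rw [← SetLike.mem_coe, ← mem_idealCompletion.1 hJ]
  exact ⟨A, hA, hw⟩

theorem exists_isTrim_of_mem_idealCompletion (hJ : w ∈ idealCompletion Y J) (hp : p ∈ J) :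
    ∃ A, IsTrim Y p A ∧ w ∈ A := by
  rwa [← SetLike.mem_coe, ← mem_idealCompletion.1 hJ] at hp

namespace IsTrimPartition

variable (hY : IsTrimPartition Y)
include hY

/-- A type is recovered from any of its trim sets, and there are only countably many compact open
sets. -/
theorem countable [SecondCountableTopology W] : Countable P := by
  choose f hf using hY.exists_isTrim
  have := (countable_isCompact_isOpen W).to_subtype
  refine Function.Injective.countable
    (f := fun p => (⟨f p, (hf p).isCompact, (hf p).isOpen⟩ :
      {A : Set W | IsCompact A ∧ IsOpen A})) fun p q h => ?_
  have h : f p = f q := congrArg Subtype.val h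
  have h2 := (hf q).type_eq
  rw [← h, (hf p).type_eq] at h2
  exact Ici_injective h2

variable [T2Space W]

theorem exists_mem_idealCompletion (w : W) : ∃ J, w ∈ idealCompletion Y J :=
  ⟨(hY.isIdeal_trimIdeal w).toIdeal, rfl⟩

theorem idealCompletion_principal (p : P) :
    idealCompletion Y (Order.Ideal.principal p) = Y p :=
  Set.ext fun _ => ⟨hY.mem_of_trimIdeal_eq, hY.trimIdeal_eq_of_mem⟩

/-- An ideal that contains the type of a trim set is realized by a point of that set. -/
theorem exists_mem_idealCompletion_of_isTrim [SecondCountableTopology W] (hA : IsTrim Y p A)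
    (hp : p ∈ J) : ∃ w ∈ A, w ∈ idealCompletion Y J := by
  have hcP := hY.countable
  have hcW := (countable_isCompact_isOpen W).to_subtype
  -- The forcing conditions are trim subsets of `A` with type in `J`, smaller sets being stronger.
  -- The cofinal families ask that the type pass a given `q ∈ J`, and that a given compact open set
  -- be decided.
  let T := {B : Set W // ∃ q ∈ J, IsTrim Y q B ∧ B ⊆ A}
  let D : J ⊕ {B : Set W | IsCompact B ∧ IsOpen B} → Order.Cofinal Tᵒᵈ := Sum.elim
    (fun q => ⟨{B | q.1 ∈ {q | ∃ r ∈ J, q ≤ r ∧ IsTrim Y r (OrderDual.ofDual B).1}}, by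
      rintro ⟨B, p, hpJ, hB, hBA⟩
      obtain ⟨r, hrJ, hpr, hqr⟩ := J.directed p hpJ q.1 q.2
      obtain ⟨x, hxB, hx⟩ := hB.mem_typeOf_iff.2 hpr
      obtain ⟨C, hC, -, hCB⟩ := hY.exists_isTrim_subset hx (hB.mem_nhds hxB)
      exact ⟨OrderDual.toDual ⟨C, r, hrJ, hC, hCB.trans hBA⟩, ⟨r, hrJ, hqr, hC⟩, hCB⟩⟩)
    (fun C => ⟨{B | (OrderDual.ofDual B).1 ⊆ C.1 ∨ Disjoint (OrderDual.ofDual B).1 C.1}, by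
      rintro ⟨B, p, hpJ, hB, hBA⟩
      obtain ⟨x, hxB, hx⟩ := hB.self_mem_typeOf
      by_cases hxC : x ∈ C.1
      · obtain ⟨E, hE, -, hEB⟩ := hY.exists_isTrim_subset hx
          ((hB.isOpen.inter C.2.2).mem_nhds ⟨hxB, hxC⟩)
        exact ⟨OrderDual.toDual ⟨E, p, hpJ, hE, (hEB.trans inter_subset_left).trans hBA⟩,
          Or.inl (hEB.trans inter_subset_right), hEB.trans inter_subset_left⟩
      · obtain ⟨E, hE, -, hEB⟩ := hY.exists_isTrim_subset hx
          ((hB.isOpen.inter C.2.1.isClosed.isOpen_compl).mem_nhds ⟨hxB, hxC⟩)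
        exact ⟨OrderDual.toDual ⟨E, p, hpJ, hE, (hEB.trans inter_subset_left).trans hBA⟩,
          Or.inr (disjoint_left.2 fun y hy => (hEB hy).2), hEB.trans inter_subset_left⟩⟩)
  have : Encodable (J ⊕ {B : Set W | IsCompact B ∧ IsOpen B}) := Encodable.ofCountable _
  let G := Order.idealOfCofinals (OrderDual.toDual (⟨A, p, hp, hA, Subset.rfl⟩ : T)) D
  obtain ⟨w, hw⟩ : (⋂₀ ((fun B : Tᵒᵈ => (OrderDual.ofDual B).1) '' (G : Set Tᵒᵈ))).Nonempty := by
    have : Nonempty ((fun B : Tᵒᵈ => (OrderDual.ofDual B).1) '' (G : Set Tᵒᵈ)) :=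
      (G.nonempty.image _).to_subtype
    refine IsCompact.nonempty_sInter_of_directed_nonempty_isCompact_isClosed ?_ ?_ ?_ ?_
    · rintro _ ⟨B, hB, rfl⟩ _ ⟨C, hC, rfl⟩
      obtain ⟨E, hE, h1, h2⟩ := G.directed B hB C hC
      exact ⟨_, ⟨E, hE, rfl⟩, h1, h2⟩
    · rintro _ ⟨⟨B, q, hq, hB, hBA⟩, -, rfl⟩
      exact hB.self_mem_typeOf.mono inter_subset_left
    · rintro _ ⟨⟨B, q, hq, hB, hBA⟩, -, rfl⟩
      exact hB.isCompact
    · rintro _ ⟨⟨B, q, hq, hB, hBA⟩, -, rfl⟩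
      exact hB.isCompact.isClosed
  have hwG : ∀ B ∈ G, w ∈ (OrderDual.ofDual B).1 := fun B hB => hw _ ⟨B, hB, rfl⟩
  refine ⟨w, hwG _ (Order.mem_idealOfCofinals _ D), Subset.antisymm ?_ fun q hq => ?_⟩
  -- A trim neighbourhood `C` of `w` cannot be disjoint from the member of `G` that decides it, so
  -- it contains a trim set with type in `J`.
  · rintro q ⟨C, hC, hwC⟩
    obtain ⟨B, hBD, hBG⟩ := Order.cofinal_meets_idealOfCofinals
      (OrderDual.toDual (⟨A, p, hp, hA, Subset.rfl⟩ : T)) D (Sum.inr ⟨C, hC.isCompact, hC.isOpen⟩)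
    obtain ⟨r, hrJ, hB, -⟩ := (OrderDual.ofDual B).2
    rcases hBD with hBC | hBC
    · exact J.lower (hC.mem_typeOf_iff.1 (typeOf_mono hBC hB.self_mem_typeOf)) hrJ
    · exact absurd hwC (disjoint_left.1 hBC (hwG _ hBG))
  · obtain ⟨B, ⟨r, hrJ, hqr, hB⟩, hBG⟩ := Order.cofinal_meets_idealOfCofinals
      (OrderDual.toDual (⟨A, p, hp, hA, Subset.rfl⟩ : T)) D (Sum.inl ⟨q, hq⟩)
    exact (hY.isIdeal_trimIdeal w).IsLowerSet hqr ⟨_, hB, hwG _ hBG⟩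

theorem mem_typeOf_idealCompletion_iff [SecondCountableTopology W] (hA : IsOpen A) :
    J ∈ typeOf (idealCompletion Y) A ↔ ∃ p ∈ J, p ∈ typeOf Y A := by
  constructor
  · rintro ⟨w, hwA, hw⟩
    obtain ⟨p, B, hB, hwB, hBA⟩ := hY.trimBase w A (hA.mem_nhds hwA)
    exact ⟨p, hB.mem_of_mem_idealCompletion hwB hw, typeOf_mono hBA hB.self_mem_typeOf⟩
  · rintro ⟨p, hp, x, hxA, hx⟩
    obtain ⟨B, hB, -, hBA⟩ := hY.exists_isTrim_subset hx (hA.mem_nhds hxA)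
    obtain ⟨w, hwB, hw⟩ := hY.exists_mem_idealCompletion_of_isTrim hB hp
    exact ⟨w, hBA hwB, hw⟩

theorem isTrim_idealCompletion [SecondCountableTopology W] (hA : IsTrim Y p A) :
    IsTrim (idealCompletion Y) (Order.Ideal.principal p) A := by
  refine isTrim_of hA.isCompact hA.isOpen (fun J => ?_) ?_
  · rw [hY.mem_typeOf_idealCompletion_iff hA.isOpen, Order.Ideal.principal_le_iff]
    simp only [hA.mem_typeOf_iff]
    exact ⟨fun ⟨q, hq, hpq⟩ => J.lower hpq hq, fun hp => ⟨p, hp, le_rfl⟩⟩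
  · rw [discreteElts_ideal, hY.idealCompletion_principal]
    rintro ⟨q, hq, hqp⟩ w hw v hv
    exact hA.eq_of_mem (principal_injective hqp ▸ hq) hw hv

theorem exists_isTrim_of_isTrim_idealCompletion [SecondCountableTopology W]
    (hA : IsTrim (idealCompletion Y) J A) : ∃ p, J = Order.Ideal.principal p ∧ IsTrim Y p A := by
  -- `J` is the least type of `A`, but the principal ideal of this `p ∈ J` is also a type of `A`; so
  -- the two agree.
  obtain ⟨p, hpJ, hpA⟩ := (hY.mem_typeOf_idealCompletion_iff hA.isOpen).1 hA.self_mem_typeOf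
  obtain rfl : J = Order.Ideal.principal p := by
    refine le_antisymm (hA.mem_typeOf_iff.1 ?_) (Order.Ideal.principal_le_iff.2 hpJ)
    exact (hY.mem_typeOf_idealCompletion_iff hA.isOpen).2 ⟨p, Order.Ideal.mem_principal_self, hpA⟩
  refine ⟨p, rfl, isTrim_of hA.isCompact hA.isOpen (fun q => ?_) fun hp w hw v hv => ?_⟩
  · have := hA.mem_typeOf_iff (q := Order.Ideal.principal q)
    rw [Order.Ideal.principal_le_iff, Order.Ideal.mem_principal] at this
    rw [← this, typeOf, typeOf, mem_ofPred, mem_ofPred, hY.idealCompletion_principal]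
  · refine hA.eq_of_mem (discreteElts_ideal P ▸ mem_image_of_mem _ hp) ?_ ?_ <;>
      rwa [hY.idealCompletion_principal]

end IsTrimPartition

theorem exists_lt_of_ne_principal (hJ : ∀ p, J ≠ Order.Ideal.principal p) (hp : p ∈ J) :
    ∃ q ∈ J, p < q := by
  by_contra! h
  refine hJ p (le_antisymm (fun q hq => ?_) (Order.Ideal.principal_le_iff.2 hp))
  obtain ⟨r, hr, hpr, hqr⟩ := J.directed p hp q hq
  rcases hpr.eq_or_lt with rfl | hpr
  · exact hqr
  · exact absurd hpr (h r hr)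

/-- Principal ideals are compact elements: the union of an increasing sequence of ideals is an
ideal, so if the supremum is principal, its generator already lies in some term, and the sequence
stops growing there. -/
theorem isSeparated_principal (p : P) : IsSeparated (Order.Ideal.principal p) := by
  rintro ⟨s, hs, hlub⟩
  have hdir : Order.IsIdeal (⋃ n, (s n : Set P)) := by
    refine ⟨isLowerSet_iUnion fun n => (s n).lower, ?_, ?_⟩
    · obtain ⟨q, hq⟩ := (s 0).nonempty
      exact ⟨q, mem_iUnion.2 ⟨0, hq⟩⟩
    · intro q hq r hr
      obtain ⟨m, hm⟩ := mem_iUnion.1 hq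
      obtain ⟨n, hn⟩ := mem_iUnion.1 hr
      obtain ⟨t, ht, h⟩ := (s (max m n)).directed q (hs.monotone (le_max_left m n) hm) r
        (hs.monotone (le_max_right m n) hn)
      exact ⟨t, mem_iUnion.2 ⟨_, ht⟩, h⟩
  have hle : Order.Ideal.principal p ≤ hdir.toIdeal := hlub.2 <| by
    rintro _ ⟨n, rfl⟩
    exact subset_iUnion (fun n => (s n : Set P)) n
  obtain ⟨n, hn⟩ := mem_iUnion.1 (hle Order.Ideal.mem_principal_self)
  exact (hs n.lt_succ_self).not_ge
    ((hlub.1 (mem_range_self _)).trans (Order.Ideal.principal_le_iff.2 hn))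

theorem exists_eq_principal_of_isSeparated [Countable P] (hJ : IsSeparated J) :
    ∃ p, J = Order.Ideal.principal p := by
  by_contra! h
  have hstep : ∀ p q : J, ∃ r : J, p < r ∧ q ≤ r := fun p q => by
    obtain ⟨r, hr, hpr, hqr⟩ := J.directed p.1 p.2 q.1 q.2
    obtain ⟨t, ht, hrt⟩ := exists_lt_of_ne_principal h hr
    exact ⟨⟨t, ht⟩, hpr.trans_lt hrt, hqr.trans hrt.le⟩
  choose next hlt hle using hstep
  have : Nonempty J := J.nonempty.to_subtype
  obtain ⟨f, hf⟩ := exists_surjective_nat J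
  -- `s (n + 1)` lies strictly above `s n` and above `f n`, so `s` is strictly increasing and
  -- cofinal in `J`.
  let s : ℕ → J := fun n => Nat.rec (f 0) (fun n p => next p (f n)) n
  have hs : StrictMono s := strictMono_nat_of_lt_succ fun n => hlt _ _
  refine hJ ⟨fun n => Order.Ideal.principal (s n).1, fun m n hmn => ?_, ?_, fun K hK q hq => ?_⟩
  · refine lt_of_le_of_ne ?_ fun h => ?_
    · exact Order.Ideal.principal_le_iff.2 (hs hmn).le
    · exact (hs hmn).ne (Subtype.ext (principal_injective h))
  · rintro _ ⟨n, rfl⟩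
    exact Order.Ideal.principal_le_iff.2 (s n).2
  · obtain ⟨n, hn⟩ := hf ⟨q, hq⟩
    refine K.lower (show q ≤ (s (n + 1)).1 from ?_)
      (Order.Ideal.principal_le_iff.1 (hK (mem_range_self (n + 1))))
    have hfs : f n ≤ s (n + 1) := hle (s n) (f n)
    rwa [hn] at hfs

end IdealCompletion

/-! ### The completion as a rank and semi-trim partition; regular refinements. -/

section Completion

variable {W : Type*} [TopologicalSpace W] [T2Space W] [SecondCountableTopology W]
  {P Q : Type*} [POSystem P] [POSystem Q] {Y : P → Set W} {V : Q → Set W}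

namespace IsTrimPartition

variable (hY : IsTrimPartition Y)
include hY

theorem isPPartition_idealCompletion : IsPPartition (idealCompletion Y) where
  nonempty J := by
    obtain ⟨p, hp⟩ := J.nonempty
    obtain ⟨A, hA⟩ := hY.exists_isTrim p
    obtain ⟨w, -, hw⟩ := hY.exists_mem_idealCompletion_of_isTrim hA hp
    exact ⟨w, hw⟩
  disjoint J K hJK := disjoint_left.2 fun _ hJ hK => hJK (SetLike.coe_injective (hJ.symm.trans hK))
  derived J := by
    ext w
    obtain ⟨K, hK⟩ := hY.exists_mem_idealCompletion w
    have hKL : ∀ L, w ∈ idealCompletion Y L → K = L := fun L hL =>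
      SetLike.coe_injective (hK.symm.trans hL)
    have hR : (w ∈ ⋃ L ∈ {L | prec L J}, idealCompletion Y L) ↔ prec K J := by
      simp only [mem_iUnion₂]
      constructor
      · rintro ⟨L, hL, hw⟩
        exact hKL L hw ▸ hL
      · exact fun h => ⟨K, h, hK⟩
    rw [hR, mem_inter_iff, and_iff_left (mem_iUnion.2 ⟨K, hK⟩), mem_derivedSet, accPt_iff_nhds]
    constructor
    · intro h
      have hle : K ≤ J := fun p hp => by
        obtain ⟨A, hA, hwA⟩ := exists_isTrim_of_mem_idealCompletion hK hp
        obtain ⟨v, ⟨hvA, hv⟩, -⟩ := h A (hA.mem_nhds hwA)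
        exact hA.mem_of_mem_idealCompletion hvA hv
      by_cases hd : K ∈ discreteElts (Order.Ideal P)
      · refine prec_of_lt (hle.lt_of_ne ?_)
        rintro rfl
        rw [discreteElts_ideal] at hd
        obtain ⟨p, hp, rfl⟩ := hd
        rw [hY.idealCompletion_principal] at h hK
        obtain ⟨A, hA, hwA, -⟩ := hY.exists_isTrim_subset hK univ_mem
        obtain ⟨v, hv, hvw⟩ := h A (hA.mem_nhds hwA)
        exact hvw (hA.eq_of_mem hp hv ⟨hwA, hK⟩)
      · exact prec_of_le_of_notMem_discreteElts hle hd
    · intro h U hU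
      by_cases hpr : ∃ p, K = Order.Ideal.principal p ∧ J = Order.Ideal.principal p
      · obtain ⟨p, rfl, rfl⟩ := hpr
        rw [hY.idealCompletion_principal] at hK ⊢
        exact hY.exists_ne_of_prec hK (prec_principal_iff.1 h) hU
      obtain ⟨p, A, hA, hwA, hAU⟩ := hY.trimBase w U hU
      have hpK := hA.mem_of_mem_idealCompletion hwA hK
      rcases h.le.lt_or_eq with hlt | rfl
      · obtain ⟨v, hvA, hv⟩ := hY.exists_mem_idealCompletion_of_isTrim hA (h.le hpK)
        refine ⟨v, ⟨hAU hvA, hv⟩, ?_⟩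
        rintro rfl
        exact hlt.ne (hKL J hv)
      -- A non-principal ideal accumulates at its own points: `A` contains a point `x` of `Y p`,
      -- which differs from `w`, and the ideal is realized again near `x`, away from `w`.
      · have hne : ∀ p, K ≠ Order.Ideal.principal p := fun p hp => hpr ⟨p, hp, hp⟩
        obtain ⟨x, hxA, hx⟩ := hA.self_mem_typeOf
        have hxw : x ≠ w := by
          rintro rfl
          exact hne p (hKL _ (hY.idealCompletion_principal p ▸ hx))
        obtain ⟨B, hB, -, hBA⟩ := hY.exists_isTrim_subset hx
          (inter_mem (hA.mem_nhds hxA) (isOpen_ne.mem_nhds hxw))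
        obtain ⟨v, hvB, hv⟩ := hY.exists_mem_idealCompletion_of_isTrim hB hpK
        exact ⟨v, ⟨hAU (hBA hvB).1, hv⟩, (hBA hvB).2⟩

/-- For RP1, a separated ideal is principal, and a `p`-trim neighbourhood of the limit forces `p`
into the ideals of all nearby points. For RP2, a non-principal `J` is approached through points of
parts `Y p` with `p ∈ J`. -/
theorem isRankPartition_idealCompletion : IsRankPartition (idealCompletion Y) where
  toIsPPartition := hY.isPPartition_idealCompletion
  complete := eq_univ_of_forall fun w => mem_iUnion.2 (hY.exists_mem_idealCompletion w)
  rp1 := by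
    intro K hK x J hx hKJ xs Js hxs hlim _
    have := hY.countable
    obtain ⟨p, rfl⟩ := exists_eq_principal_of_isSeparated hK
    obtain ⟨A, hA, hxA⟩ := exists_isTrim_of_mem_idealCompletion hx
      (Order.Ideal.principal_le_iff.1 hKJ)
    filter_upwards [hlim (hA.mem_nhds hxA)] with k hk
    exact Order.Ideal.principal_le_iff.2 (hA.mem_of_mem_idealCompletion hk (hxs k))
  rp2 := by
    intro x J hx hJ
    have hJ : ∀ p, J ≠ Order.Ideal.principal p := by
      rintro p rfl
      exact hJ (isSeparated_principal p)
    obtain ⟨U, hU⟩ := (𝓝 x).exists_antitone_basis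
    have h : ∀ n, ∃ p, Order.Ideal.principal p < J ∧ (U n ∩ Y p).Nonempty := fun n => by
      obtain ⟨p, A, hA, hxA, hAU⟩ := hY.trimBase x (U n) (hU.mem n)
      have hp := hA.mem_of_mem_idealCompletion hxA hx
      exact ⟨p, (Order.Ideal.principal_le_iff.2 hp).lt_of_ne (hJ p).symm,
        typeOf_mono hAU hA.self_mem_typeOf⟩
    choose ps hps xs hxs using h
    refine ⟨xs, fun n => Order.Ideal.principal (ps n), fun n => ?_,
      hU.tendsto fun n => (hxs n).1, hps⟩
    rw [hY.idealCompletion_principal]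
    exact (hxs n).2

theorem hasTrimBase_idealCompletion : HasTrimBase (idealCompletion Y) := fun w U hU => by
  obtain ⟨p, A, hA, hw, hAU⟩ := hY.trimBase w U hU
  exact ⟨_, A, hY.isTrim_idealCompletion hA, hw, hAU⟩

theorem mem_trimTypes_idealCompletion_iff {J : Order.Ideal P} :
    J ∈ trimTypes (idealCompletion Y) ↔ ∃ p, Order.Ideal.principal p = J := by
  constructor
  · rintro ⟨A, hA⟩
    obtain ⟨p, rfl, -⟩ := hY.exists_isTrim_of_isTrim_idealCompletion hA
    exact ⟨p, rfl⟩
  · rintro ⟨p, rfl⟩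
    obtain ⟨A, hA⟩ := hY.exists_isTrim p
    exact ⟨A, hY.isTrim_idealCompletion hA⟩

theorem setOf_isClean_idealCompletion (p : P) :
    {w ∈ idealCompletion Y (Order.Ideal.principal p) | IsClean (idealCompletion Y) w} = Y p := by
  rw [hY.idealCompletion_principal]
  refine Subset.antisymm (fun w hw => hw.1) fun w hw => ⟨hw, Order.Ideal.principal p, ?_, ?_⟩
  · rwa [hY.idealCompletion_principal]
  · obtain ⟨A, hA, hwA, -⟩ := hY.exists_isTrim_subset hw univ_mem
    exact ⟨A, hY.isTrim_idealCompletion hA, hwA⟩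

theorem isSemiTrimPartition_idealCompletion : IsSemiTrimPartition (idealCompletion Y) where
  toIsPPartition := hY.isPPartition_idealCompletion
  trimBase := hY.hasTrimBase_idealCompletion
  full := by
    intro J hJ w hw
    obtain ⟨p, rfl⟩ := hY.mem_trimTypes_idealCompletion_iff.1 hJ
    rw [hY.idealCompletion_principal]
    refine hY.full p (hY.trimTypes_eq ▸ mem_univ p) w fun U hU => ?_
    obtain ⟨A, hA, hwA, hAU⟩ := hw U hU
    obtain ⟨q, hqp, hA⟩ := hY.exists_isTrim_of_isTrim_idealCompletion hA
    exact ⟨A, principal_injective hqp ▸ hA, hwA, hAU⟩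
  clean_dense := by
    intro J hJ
    obtain ⟨p, rfl⟩ := hY.mem_trimTypes_idealCompletion_iff.1 hJ
    rw [hY.setOf_isClean_idealCompletion, hY.idealCompletion_principal]
    exact subset_closure

theorem exists_equiv_cleanInterior_idealCompletion :
    ∃ e : P ≃ trimTypes (idealCompletion Y),
      (∀ p, (e p : Order.Ideal P) = Order.Ideal.principal p) ∧
      SamePartition Y (cleanInterior (idealCompletion Y)) e := by
  refine ⟨Equiv.ofBijective
    (fun p => ⟨_, hY.mem_trimTypes_idealCompletion_iff.2 ⟨p, rfl⟩⟩) ⟨?_, ?_⟩, fun p => rfl, ?_, ?_⟩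
  · exact fun p q h => principal_injective (congrArg Subtype.val h)
  · rintro ⟨J, hJ⟩
    obtain ⟨p, rfl⟩ := hY.mem_trimTypes_idealCompletion_iff.1 hJ
    exact ⟨p, rfl⟩
  · exact fun p q => (prec_coe_iff _ _).symm.trans prec_principal_iff
  · exact hY.setOf_isClean_idealCompletion

theorem isRegularExtension_idealCompletion :
    IsRegularExtension (idealCompletion Y) Y Order.Ideal.principal where
  injective := principal_injective
  prec_iff _ _ := prec_principal_iff
  isPPartition := hY.isPPartition_idealCompletion
  semiTrim := hY.isSemiTrimPartition
  part_subset q := (hY.idealCompletion_principal q).ge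
  regular A _ hA J hJ := by
    obtain ⟨q, hqJ, hq⟩ := (hY.mem_typeOf_idealCompletion_iff hA).1 hJ
    exact ⟨q, hq, Order.Ideal.principal_le_iff.2 hqJ⟩

theorem exists_regularlyRefines_of_isCompletePartition (hV : IsSemiTrimPartition V)
    (hc : IsCompletePartition V) (e : P ≃ trimTypes V) (he : SamePartition Y (cleanInterior V) e) :
    ∃ β : Order.Ideal P → Q,
      (∀ J : Order.Ideal P, IsLUB ((fun p => (e p : Q)) '' (J : Set P)) (β J)) ∧
      RegularlyRefines (idealCompletion Y) V β := by
  have hprec : ∀ {p p'}, prec (e p : Q) (e p') ↔ prec p p' := fun {p p'} =>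
    (prec_coe_iff _ _).trans (he.prec_iff p p')
  have hle : ∀ {p p'}, (e p : Q) ≤ e p' ↔ p ≤ p' := fun {p p'} => by
    rw [le_iff_prec_or_eq, le_iff_prec_or_eq, hprec, Subtype.coe_inj, e.injective.eq_iff]
  have hsub : ∀ p, Y p ⊆ V (e p) := fun p w hw => by
    rw [← he.part_eq p] at hw
    exact hw.1
  -- An open set meeting `V (e p')` meets its clean points, which form `Y p'`, by density.
  have htrim : ∀ {p A}, IsTrim V (e p) A → IsTrim Y p A := fun {p A} hA => by
    refine isTrim_of hA.isCompact hA.isOpen (fun p' => ⟨?_, fun h => ?_⟩) fun hp w hw v hv => ?_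
    · rintro ⟨w, hwA, hw⟩
      exact hle.1 (hA.le hwA (hsub _ hw))
    · obtain ⟨w, hwA, hw⟩ := hA.mem_typeOf_iff.2 (hle.2 h)
      rw [typeOf, mem_ofPred, ← he.part_eq p']
      exact mem_closure_iff.1 (hV.clean_dense _ (e p').2 hw) A hA.isOpen hwA
    · exact hA.eq_of_mem (fun h => hp (hprec.1 h)) ⟨hw.1, hsub _ hw.2⟩ ⟨hv.1, hsub _ hv.2⟩
  have hbase : ∀ w, ∀ U ∈ 𝓝 w, ∃ p A, IsTrim V (e p) A ∧ w ∈ A ∧ A ⊆ U := fun w U hU => by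
    obtain ⟨q, A, hA, h⟩ := hV.trimBase w U hU
    refine ⟨e.symm ⟨q, A, hA⟩, A, ?_, h⟩
    rwa [e.apply_symm_apply]
  have key : ∀ (J : Order.Ideal P) (w : W), w ∈ idealCompletion Y J → ∀ q, w ∈ V q →
      IsLUB ((fun p => (e p : Q)) '' (J : Set P)) q := by
    intro J w hw q hq
    constructor
    · rintro _ ⟨p, hp, rfl⟩
      obtain ⟨A, hA, hwA⟩ := exists_isTrim_of_mem_idealCompletion hw hp
      obtain ⟨p', B, hB, hwB, hBA⟩ := hbase w A (hA.mem_nhds hwA)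
      have hpp' := hA.mem_typeOf_iff.1 (typeOf_mono hBA (htrim hB).self_mem_typeOf)
      exact (hle.2 hpp').trans (hB.le hwB hq)
    -- Every trim neighbourhood of `w` has type `e p` with `p ∈ J`, hence meets `V q'`. So `w` lies
    -- in `V q'` or in its derived set, and either way its label `q` is at most `q'`.
    · intro q' hq'
      by_cases hwq' : w ∈ V q'
      · by_contra h
        exact disjoint_left.1 (hV.disjoint fun h' => h h'.le) hq hwq'
      have hacc : w ∈ derivedSet (V q') ∩ ⋃ q, V q := by
        refine ⟨accPt_iff_nhds.2 fun U hU => ?_, mem_iUnion.2 ⟨q, hq⟩⟩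
        obtain ⟨p, A, hA, hwA, hAU⟩ := hbase w U hU
        obtain ⟨v, hvA, hv⟩ := hA.mem_typeOf_iff.2
          (hq' ⟨p, (htrim hA).mem_of_mem_idealCompletion hwA hw, rfl⟩)
        exact ⟨v, ⟨hAU hvA, hv⟩, fun h => hwq' (h ▸ hv)⟩
      rw [hV.derived] at hacc
      obtain ⟨r, hr, hwr⟩ := mem_iUnion₂.1 hacc
      by_contra h
      exact disjoint_left.1 (hV.disjoint fun h' => h (h'.trans_le hr.le)) hq hwr
  choose x hx using hY.isPPartition_idealCompletion.nonempty
  have hVx : ∀ w, ∃ q, w ∈ V q := fun w => mem_iUnion.1 (hc ▸ mem_univ w)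
  -- `β J` is the label in `V` of one chosen point of `Y(J)`; by `key` every other point of `Y(J)`
  -- has the same label.
  choose β hβ using fun J => hVx (x J)
  have hlub := fun J => key J (x J) (hx J) (β J) (hβ J)
  refine ⟨β, hlub, hY.isPPartition_idealCompletion, hV.toIsPPartition, fun J w hw => ?_,
    hY.hasTrimBase_idealCompletion, hV.trimBase, fun q hq A hA => ?_⟩
  · obtain ⟨q, hq⟩ := hVx w
    exact (key J w hw q hq).unique (hlub J) ▸ hq
  · obtain ⟨p, hp⟩ := e.surjective ⟨q, hq⟩
    obtain rfl : (e p : Q) = q := congrArg Subtype.val hp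
    refine ⟨Order.Ideal.principal p,
      (hY.isTrim_idealCompletion (htrim hA)).self_mem_typeOf, (hlub _).unique ?_⟩
    refine IsGreatest.isLUB ⟨⟨p, Order.Ideal.mem_principal_self, rfl⟩, ?_⟩
    rintro _ ⟨p', hp', rfl⟩
    exact hle.2 hp'

end IsTrimPartition

theorem IsMorphism.monotone {α : Q → P} (hα : IsMorphism α) : Monotone α := fun q r h => by
  rcases le_iff_prec_or_eq.1 h with h | rfl
  · have : α r ∈ {p | prec (α q) p} := hα q ▸ mem_image_of_mem α h
    exact prec.le this
  · exact le_rfl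

theorem exists_regularlyRefines_idealCompletion (hY : IsTrimPartition Y) (hV : IsTrimPartition V)
    {α : Q → P} (hα : Monotone α) (hr : RegularlyRefines V Y α) :
    ∃ idα : Order.Ideal Q → Order.Ideal P,
      (∀ J : Order.Ideal Q, (idα J : Set P) = {p | ∃ q ∈ J, p ≤ α q}) ∧
      RegularlyRefines (idealCompletion V) (idealCompletion Y) idα := by
  have hI : ∀ J : Order.Ideal Q, Order.IsIdeal {p | ∃ q ∈ J, p ≤ α q} := fun J => by
    refine ⟨fun p p' h ⟨q, hq, hp⟩ => ⟨q, hq, h.trans hp⟩, ?_, ?_⟩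
    · obtain ⟨q, hq⟩ := J.nonempty
      exact ⟨α q, q, hq, le_rfl⟩
    · rintro p ⟨q, hq, hp⟩ p' ⟨q', hq', hp'⟩
      obtain ⟨r, hr, hqr, hqr'⟩ := J.directed q hq q' hq'
      exact ⟨α r, ⟨r, hr, le_rfl⟩, hp.trans (hα hqr), hp'.trans (hα hqr')⟩
  refine ⟨fun J => (hI J).toIdeal, fun J => rfl, hV.isPPartition_idealCompletion,
    hY.isPPartition_idealCompletion, fun J w hw => ?_, hV.hasTrimBase_idealCompletion,
    hY.hasTrimBase_idealCompletion, fun K hK A hA => ?_⟩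
  · refine Subset.antisymm ?_ ?_
    · rintro p ⟨B, hB, hwB⟩
      obtain ⟨q, A, hA, hwA, hAB⟩ := hV.trimBase w B (hB.mem_nhds hwB)
      obtain ⟨x, hxA, hx⟩ := hA.self_mem_typeOf
      exact ⟨q, hA.mem_of_mem_idealCompletion hwA hw, hB.le (hAB hxA) (hr.refines q hx)⟩
    · rintro p ⟨q, hq, hp⟩
      obtain ⟨A, hA, hwA⟩ := exists_isTrim_of_mem_idealCompletion hw hq
      obtain ⟨p', B, hB, hwB, hBA⟩ := hY.trimBase w A (hA.mem_nhds hwA)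
      -- Regularity provides a `V`-type `q'` of `B` above the given `p'`. As `B ⊆ A`, it satisfies
      -- `q ≤ q'`, whence `p ≤ α q ≤ α q'`.
      obtain ⟨q', hq', rfl⟩ := hr.regular p' (hY.trimTypes_eq ▸ mem_univ _) B hB
      have hqq' := hA.mem_typeOf_iff.1 (typeOf_mono hBA hq')
      exact (hY.isIdeal_trimIdeal w).IsLowerSet (hp.trans (hα hqq')) ⟨B, hB, hwB⟩
  · obtain ⟨p, rfl, hpA⟩ := hY.exists_isTrim_of_isTrim_idealCompletion hA
    obtain ⟨q, hq, rfl⟩ := hr.regular p (hY.trimTypes_eq ▸ mem_univ _) A hpA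
    refine ⟨Order.Ideal.principal q, (hV.mem_typeOf_idealCompletion_iff hA.isOpen).2
      ⟨q, Order.Ideal.mem_principal_self, hq⟩, ?_⟩
    refine SetLike.coe_injective (Set.ext fun p => ?_)
    exact ⟨fun ⟨r, hr, hp⟩ => hp.trans (hα hr), fun hp => ⟨q, le_rfl, hp⟩⟩

end Completion

/-! ### Partitions of compact open sets into trim sets. -/

section TrimDecomposition

variable {W : Type*} [TopologicalSpace W] {P : Type*} [POSystem P] {Y : P → Set W}
  {p q : P} {A B C : Set W} {v w : W}

/-- `s` is a finite partition of `A` into trim sets. -/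
structure IsTrimDecomposition (Y : P → Set W) (A : Set W) (s : Finset (Set W)) : Prop where
  trim : ∀ B ∈ s, ∃ p, IsTrim Y p B
  disjoint : (s : Set (Set W)).PairwiseDisjoint id
  sUnion_eq : ⋃₀ (s : Set (Set W)) = A

open Classical in
theorem IsTrimDecomposition.union {s t : Finset (Set W)} (hs : IsTrimDecomposition Y A s)
    (ht : IsTrimDecomposition Y B t) (hAB : Disjoint A B) :
    IsTrimDecomposition Y (A ∪ B) (s ∪ t) where
  trim C hC := (Finset.mem_union.1 hC).elim (hs.trim C) (ht.trim C)
  disjoint := by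
    rw [Finset.coe_union]
    refine hs.disjoint.union ht.disjoint fun C hC D hD _ => hAB.mono ?_ ?_
    · exact hs.sUnion_eq ▸ subset_sUnion_of_mem hC
    · exact ht.sUnion_eq ▸ subset_sUnion_of_mem hD
  sUnion_eq := by rw [Finset.coe_union, sUnion_union, hs.sUnion_eq, ht.sUnion_eq]

theorem IsTrimDecomposition.subset {s : Finset (Set W)} (hs : IsTrimDecomposition Y A s)
    (hC : C ∈ s) : C ⊆ A := hs.sUnion_eq ▸ subset_sUnion_of_mem hC

namespace IsTrimPartition

variable [T2Space W] (hY : IsTrimPartition Y)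
include hY

open Classical in
-- Fix a member `B`. If removing `B` from some `C` destroys its least type, then `B ∪ C` is trim and
-- replaces both. Otherwise all differences `C \ B` stay trim, and `B` is split off. Either way the
-- number of sets left to treat drops.
theorem exists_isTrimDecomposition_of_card_le (n : ℕ) : ∀ s : Finset (Set W), s.card ≤ n →
    (∀ B ∈ s, ∃ p, IsTrim Y p B) → ∃ t, IsTrimDecomposition Y (⋃₀ (s : Set (Set W))) t := by
  induction n with
  | zero =>
    intro s hs _
    obtain rfl := Finset.card_eq_zero.1 (Nat.le_zero.1 hs)
    exact ⟨∅, by simp, by simp, rfl⟩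
  | succ n ih =>
    intro s hs h
    rcases s.eq_empty_or_nonempty with rfl | ⟨B, hB⟩
    · exact ⟨∅, by simp, by simp, rfl⟩
    obtain ⟨s, hBs, rfl⟩ : ∃ t, B ∉ t ∧ insert B t = s :=
      ⟨s.erase B, Finset.notMem_erase B s, Finset.insert_erase hB⟩
    rw [Finset.card_insert_of_notMem hBs, Nat.add_le_add_iff_right] at hs
    obtain ⟨p, hp⟩ := h B hB
    by_cases hs' : ∃ C ∈ s, ∃ q, IsTrim Y q C ∧ q ∉ typeOf Y (C \ B)
    · obtain ⟨C, hC, q, hq, hqB⟩ := hs'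
      have hsub : C ∩ Y q ⊆ B := fun x hx => by
        by_contra hxB
        exact hqB ⟨x, ⟨hx.1, hxB⟩, hx.2⟩
      obtain ⟨x, hx⟩ := hq.self_mem_typeOf
      have hpq := hp.le (hsub hx) hx.2
      have hBC : IsTrim Y p (B ∪ C) := hp.union hq hpq fun _ y hy => by
        obtain rfl := le_antisymm hpq (hq.le hy.1 hy.2)
        exact hsub hy
      obtain ⟨t, ht⟩ := ih (insert (B ∪ C) (s.erase C))
        ((Finset.card_insert_le _ _).trans (by rwa [Finset.card_erase_add_one hC])) (by
          intro D hD
          rcases Finset.mem_insert.1 hD with rfl | hD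
          · exact ⟨p, hBC⟩
          · exact h D (Finset.mem_insert_of_mem (Finset.mem_of_mem_erase hD)))
      refine ⟨t, ?_⟩
      convert ht using 1
      conv_lhs => rw [← Finset.insert_erase hC]
      simp only [Finset.coe_insert, sUnion_insert, union_assoc]
    · push Not at hs'
      obtain ⟨t, ht⟩ := ih (s.image (· \ B)) (Finset.card_image_le.trans hs) (by
        intro D hD
        obtain ⟨C, hC, rfl⟩ := Finset.mem_image.1 hD
        obtain ⟨q, hq⟩ := h C (Finset.mem_insert_of_mem hC)
        exact ⟨q, hY.isTrim_of_subset hq sdiff_subset (hq.isCompact.diff hp.isOpen)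
          (hq.isOpen.sdiff hp.isCompact.isClosed) (hs' C hC q hq)⟩)
      have hBt : IsTrimDecomposition Y B {B} := ⟨by simpa using ⟨p, hp⟩, by simp, by simp⟩
      refine ⟨{B} ∪ t, ?_⟩
      convert hBt.union ht ?_ using 1
      · ext x
        simp only [Finset.coe_insert, sUnion_insert, Finset.coe_image, sUnion_image, mem_union,
          mem_sUnion, mem_iUnion, Set.mem_sdiff, Finset.mem_coe]
        by_cases hx : x ∈ B <;> simp [hx]
      · refine disjoint_sUnion_right.2 fun D hD => ?_
        obtain ⟨C, -, rfl⟩ := Finset.mem_image.1 hD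
        exact disjoint_sdiff_right

theorem exists_isTrimDecomposition (hc : IsCompact A) (ho : IsOpen A) :
    ∃ s, IsTrimDecomposition Y A s := by
  obtain ⟨T, hT, hfin, hAT⟩ := hc.elim_finite_subcover_image
    (b := {B | B ⊆ A ∧ ∃ p, IsTrim Y p B}) (c := id) (fun B ⟨_, _, hB⟩ => hB.isOpen) (by
      intro x hx
      obtain ⟨p, B, hB, hxB, hBA⟩ := hY.trimBase x A (ho.mem_nhds hx)
      exact mem_biUnion (show B ∈ {B | B ⊆ A ∧ ∃ p, IsTrim Y p B} from ⟨hBA, p, hB⟩) hxB)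
  obtain ⟨s, hs⟩ := hY.exists_isTrimDecomposition_of_card_le _ hfin.toFinset le_rfl
    fun B hB => (hT (hfin.mem_toFinset.1 hB)).2
  refine ⟨s, ?_⟩
  convert hs using 1
  rw [hfin.coe_toFinset]
  exact Subset.antisymm (by rwa [sUnion_eq_biUnion]) (sUnion_subset fun B hB => (hT hB).1)

open Classical in
theorem exists_isTrimDecomposition_deciding (hc : IsCompact A) (ho : IsOpen A) (hCc : IsCompact C)
    (hCo : IsOpen C) : ∃ s, IsTrimDecomposition Y A s ∧ ∀ B ∈ s, B ⊆ C ∨ Disjoint B C := by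
  obtain ⟨s, hs⟩ := hY.exists_isTrimDecomposition (hc.inter_right hCc.isClosed) (ho.inter hCo)
  obtain ⟨t, ht⟩ := hY.exists_isTrimDecomposition (hc.diff hCo) (ho.sdiff hCc.isClosed)
  refine ⟨s ∪ t, ?_, fun B hB => ?_⟩
  · have := hs.union ht (disjoint_sdiff_right.mono_left inter_subset_right)
    rwa [inter_union_sdiff] at this
  · rcases Finset.mem_union.1 hB with hB | hB
    · exact Or.inl ((hs.subset hB).trans inter_subset_right)
    · exact Or.inr (disjoint_sdiff_left.mono_left (ht.subset hB))

/-- Points of `Y q` accumulate at a point `y` of `B ∩ Y p`. A small `q`-trim set around one of them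
leaves `y` in the remainder, which therefore stays `p`-trim. -/
theorem exists_isTrim_diff (hB : IsTrim Y p B) (hpq : prec p q) (v : W) :
    ∃ D ⊆ B, IsTrim Y q D ∧ v ∉ D ∧ IsTrim Y p (B \ D) := by
  obtain ⟨y, hyB, hy⟩ := hB.self_mem_typeOf
  obtain ⟨x, ⟨hxB, hx⟩, hxy, hxv⟩ : ∃ x ∈ B ∩ Y q, x ≠ y ∧ x ≠ v := by
    by_cases hvy : y = v
    · subst hvy
      obtain ⟨x, hx, hne⟩ := hY.exists_ne_of_prec hy hpq (hB.mem_nhds hyB)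
      exact ⟨x, hx, hne, hne⟩
    · obtain ⟨x, hx, hne⟩ := hY.exists_ne_of_prec hy hpq
        (inter_mem (hB.mem_nhds hyB) (isOpen_ne.mem_nhds hvy))
      exact ⟨x, ⟨hx.1.1, hx.2⟩, hne, hx.1.2⟩
  obtain ⟨D, hD, -, hDU⟩ := hY.exists_isTrim_subset hx (inter_mem (hB.mem_nhds hxB)
    (inter_mem (isOpen_ne.mem_nhds hxy) (isOpen_ne.mem_nhds hxv)))
  refine ⟨D, fun z hz => (hDU hz).1, hD, fun h => (hDU h).2.2 rfl, ?_⟩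
  exact hY.isTrim_of_subset hB sdiff_subset (hB.isCompact.diff hD.isOpen)
    (hB.isOpen.sdiff hD.isCompact.isClosed) ⟨y, ⟨hyB, fun h => (hDU h).2.1 rfl⟩, hy⟩

/-- A `p`-trim set can be split into trim sets of prescribed types, the first of type `p` and
containing any prescribed point, the others of types related to `p`. -/
theorem exists_split {ι : Type*} [DecidableEq ι] (s : Finset ι) (a : ι → P) (i₀ : ι) (hi₀ : i₀ ∉ s)
    (ha : ∀ i ∈ s, prec (a i₀) (a i)) (v : W) (B : Set W) (hB : IsTrim Y (a i₀) B) :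
    ∃ D : ι → Set W, (∀ i ∈ insert i₀ s, IsTrim Y (a i) (D i)) ∧
      (insert i₀ s : Set ι).PairwiseDisjoint D ∧ ⋃ i ∈ insert i₀ s, D i = B ∧
      ∀ i ∈ s, v ∉ D i := by
  induction s using Finset.induction_on generalizing B with
  | empty => exact ⟨fun _ => B, by simpa using hB, by simp, by simp, by simp⟩
  | insert j s hj ih =>
    obtain ⟨E, hEB, hE, hvE, hBE⟩ := hY.exists_isTrim_diff hB (ha j (Finset.mem_insert_self j s)) v
    have hij : i₀ ≠ j := fun h => hi₀ (h ▸ Finset.mem_insert_self j s)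
    obtain ⟨D, hD, hdisj, hU, hv⟩ := ih (fun h => hi₀ (Finset.mem_insert_of_mem h))
      (fun i hi => ha i (Finset.mem_insert_of_mem hi)) _ hBE
    have hjs : j ∉ insert i₀ s := by simp [hj, hij.symm]
    have hne : ∀ i ∈ insert i₀ s, Function.update D j E i = D i := fun i hi =>
      Function.update_of_ne (fun h : i = j => hjs (h ▸ hi)) _ _
    refine ⟨Function.update D j E, ?_, ?_, ?_, ?_⟩
    · intro i hi
      rw [Finset.insert_comm, Finset.mem_insert] at hi
      rcases hi with rfl | hi
      · rwa [Function.update_self]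
      · rw [hne i hi]
        exact hD i hi
    · rw [Finset.coe_insert, insert_comm]
      refine PairwiseDisjoint.insert_of_notMem ?_ ?_ ?_
      · intro i hi i' hi' hii'
        have hi : i ∈ insert i₀ s := by simpa using hi
        have hi' : i' ∈ insert i₀ s := by simpa using hi'
        rw [Function.onFun, hne i hi, hne i' hi']
        exact hdisj (by simpa using hi) (by simpa using hi') hii'
      · simpa using hjs
      · intro i hi
        have hi : i ∈ insert i₀ s := by simpa using hi
        rw [hne i hi, Function.update_self]
        exact disjoint_sdiff_right.mono_right (hU ▸ subset_biUnion_of_mem (u := D) hi)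
    · rw [Finset.insert_comm, Finset.set_biUnion_insert, Function.update_self,
        iUnion₂_congr hne, hU, union_sdiff_cancel hEB]
    · intro i hi
      rcases Finset.mem_insert.1 hi with rfl | hi
      · rwa [Function.update_self]
      · rw [hne i (Finset.mem_insert_of_mem hi)]
        exact hv i hi

end IsTrimPartition

end TrimDecomposition

/-! ### Copying trim decompositions; matchings and their refinement. -/

section Matching

variable {W : Type*} [TopologicalSpace W] {P : Type*} [POSystem P] {Y : P → Set W}
  {p q : P} {A B C : Set W} {v w : W}

namespace IsTrimPartition

variable [T2Space W] (hY : IsTrimPartition Y)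
include hY

open Classical in
-- Some piece of `A` has type `p`, and all others have types related to `p`, so `B` splits in the
-- same pattern by `exists_split`. The care goes into placing `v` in the piece that corresponds to
-- the one containing `w`.
theorem exists_matching_of_mem {s : Finset (Set W)} (hA : IsTrim Y p A) (hB : IsTrim Y p B)
    (hs : IsTrimDecomposition Y A s) (hw : w ∈ A) (hv : v ∈ B)
    (hwv : trimIdeal Y w = trimIdeal Y v) :
    ∃ D : Set W → Set W, (∀ C ∈ s, ∃ q, IsTrim Y q C ∧ IsTrim Y q (D C)) ∧
      (s : Set (Set W)).PairwiseDisjoint D ∧ ⋃ C ∈ s, D C = B ∧ ∀ C ∈ s, w ∈ C ↔ v ∈ D C := by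
  have : ∃ a : Set W → P, ∀ C ∈ s, IsTrim Y (a C) C := by
    obtain ⟨A₁, hA₁⟩ := hY.exists_isTrim p
    exact ⟨fun C => if h : ∃ q, IsTrim Y q C then h.choose else p, fun C hC => by
      simp only [dif_pos (hs.trim C hC)]; exact (hs.trim C hC).choose_spec⟩
  obtain ⟨a, ha⟩ := this
  have hpa : ∀ C ∈ s, p ≤ a C := fun C hC =>
    hA.mem_typeOf_iff.1 (typeOf_mono (hs.subset hC) (ha C hC).self_mem_typeOf)
  -- For discrete `p` only one piece can contain the unique point of `A ∩ Y p`.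
  have hprec : ∀ C₁ ∈ s, a C₁ = p → ∀ C ∈ s, C ≠ C₁ → prec p (a C) := by
    intro C₁ h₁ hp C hC hne
    by_cases hd : p ∈ discreteElts P
    · refine prec_of_lt ((hpa C hC).lt_of_ne fun h => ?_)
      obtain ⟨x, hxC, hx⟩ := (ha C hC).self_mem_typeOf
      obtain ⟨y, hyC, hy⟩ := (ha C₁ h₁).self_mem_typeOf
      rw [← h] at hx
      rw [hp] at hy
      have hxy := hA.eq_of_mem hd ⟨hs.subset hC hxC, hx⟩ ⟨hs.subset h₁ hyC, hy⟩
      exact disjoint_left.1 (hs.disjoint hC h₁ hne) hxC (hxy ▸ hyC)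
    · exact prec_of_le_of_notMem_discreteElts (hpa C hC) hd
  have huniq : ∀ D : Set W → Set W, (s : Set (Set W)).PairwiseDisjoint D →
      ∀ C₀ ∈ s, w ∈ C₀ → v ∈ D C₀ → ∀ C ∈ s, w ∈ C ↔ v ∈ D C := by
    intro D hD C₀ h₀ hw₀ hv₀ C hC
    constructor
    · intro hwC
      obtain rfl : C = C₀ := by
        by_contra hne
        exact disjoint_left.1 (hs.disjoint hC h₀ hne) hwC hw₀
      exact hv₀
    · intro hvC
      obtain rfl : C = C₀ := by
        by_contra hne
        exact disjoint_left.1 (hD hC h₀ hne) hvC hv₀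
      exact hw₀
  obtain ⟨C₀, h₀, hw₀⟩ : ∃ C ∈ s, w ∈ C := by
    rw [← hs.sUnion_eq] at hw
    simpa using hw
  by_cases h : a C₀ = p
  · obtain ⟨D, hD, hdisj, hU, hvD⟩ := hY.exists_split (s.erase C₀) a C₀ (Finset.notMem_erase _ _)
      (fun C hC => h ▸ hprec C₀ h₀ h C (Finset.mem_of_mem_erase hC) (Finset.ne_of_mem_erase hC))
      v B (h ▸ hB)
    rw [Finset.insert_erase h₀] at hD hU
    rw [← Finset.coe_insert, Finset.insert_erase h₀] at hdisj
    refine ⟨D, fun C hC => ⟨a C, ha C hC, hD C hC⟩, hdisj, hU, huniq D hdisj C₀ h₀ hw₀ ?_⟩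
    rw [← hU] at hv
    obtain ⟨C, hC, hvC⟩ := mem_iUnion₂.1 hv
    by_cases hne : C = C₀
    · exact hne ▸ hvC
    · exact absurd hvC (hvD C (Finset.mem_erase.2 ⟨hne, hC⟩))
  · obtain ⟨C₁, h₁, hp₁⟩ : ∃ C ∈ s, a C = p := by
      obtain ⟨x, hxA, hx⟩ := hA.self_mem_typeOf
      rw [← hs.sUnion_eq] at hxA
      obtain ⟨C, hC, hxC⟩ := hxA
      exact ⟨C, hC, le_antisymm ((ha C hC).le hxC hx) (hpa C hC)⟩
    have h₀₁ : C₀ ≠ C₁ := fun h' => h (h' ▸ hp₁)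
    have hpa₀ := hprec C₁ h₁ hp₁ C₀ h₀ h₀₁
    have ha₀v : a C₀ ∈ trimIdeal Y v := by
      rw [← hwv]
      exact ⟨C₀, ha C₀ h₀, hw₀⟩
    -- The partner of `C₀` is carved out around `v` first, which is possible as its type lies in
    -- `I_w = I_v`. It must spare a point `y` of `Y p`; here `y ≠ v`, since otherwise `a C₀ ≤ p`.
    -- The auxiliary `D` shows that `B` without `y` still meets `Y (a C₀)`.
    obtain ⟨E, hEB, hE, hvE, hBE⟩ : ∃ E ⊆ B, IsTrim Y (a C₀) E ∧ v ∈ E ∧ IsTrim Y p (B \ E) := by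
      obtain ⟨D, hDB, hD, hvD, hBD⟩ := hY.exists_isTrim_diff hB hpa₀ v
      obtain ⟨y, hyBD, hy⟩ := hBD.self_mem_typeOf
      have hvy : y ≠ v := by
        rintro rfl
        rw [hY.trimIdeal_eq_of_mem hy] at ha₀v
        exact h (le_antisymm ha₀v (hpa C₀ h₀))
      obtain ⟨E, hE, hvE, hEU⟩ := hY.exists_isTrim_subset_of_mem_trimIdeal (B := B \ {y}) ha₀v
        (hB.isOpen.sdiff isClosed_singleton) (Set.mem_sdiff_of_mem hv hvy.symm)
        (typeOf_mono (A := D) (B := B \ {y}) (fun z hz => ⟨hDB hz, fun hzy => hyBD.2 (hzy ▸ hz)⟩) hD.self_mem_typeOf)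
      exact ⟨E, hEU.trans sdiff_subset, hE, hvE, hY.isTrim_of_subset hB sdiff_subset
        (hB.isCompact.diff hE.isOpen) (hB.isOpen.sdiff hE.isCompact.isClosed)
        ⟨y, ⟨hyBD.1, fun hyE => (hEU hyE).2 rfl⟩, hy⟩⟩
    obtain ⟨D, hD, hdisj, hU, -⟩ := hY.exists_split ((s.erase C₀).erase C₁) a C₁
      (Finset.notMem_erase _ _) (fun C hC => by
        rw [hp₁]
        exact hprec C₁ h₁ hp₁ C (Finset.mem_of_mem_erase (Finset.mem_of_mem_erase hC))
          (Finset.ne_of_mem_erase hC)) v (B \ E) (hp₁ ▸ hBE)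
    have h₁' : C₁ ∈ s.erase C₀ := Finset.mem_erase.2 ⟨h₀₁.symm, h₁⟩
    rw [Finset.insert_erase h₁'] at hD hU
    rw [← Finset.coe_insert, Finset.insert_erase h₁'] at hdisj
    have hne : ∀ C ∈ s.erase C₀, Function.update D C₀ E C = D C := fun C hC =>
      Function.update_of_ne (Finset.ne_of_mem_erase hC) _ _
    have hdisj' : (s : Set (Set W)).PairwiseDisjoint (Function.update D C₀ E) := by
      rw [← Finset.insert_erase h₀, Finset.coe_insert]
      refine PairwiseDisjoint.insert_of_notMem ?_ (by simp) ?_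
      · intro C hC C' hC' hCC'
        rw [Function.onFun, hne C hC, hne C' hC']
        exact hdisj hC hC' hCC'
      · intro C hC
        rw [hne C hC, Function.update_self]
        exact disjoint_sdiff_right.mono_right
          (hU ▸ subset_biUnion_of_mem (u := D) (show C ∈ s.erase C₀ from hC))
    refine ⟨Function.update D C₀ E, fun C hC => ⟨a C, ha C hC, ?_⟩, hdisj', ?_,
      huniq _ hdisj' C₀ h₀ hw₀ ?_⟩
    · by_cases hCC : C = C₀
      · subst hCC
        rwa [Function.update_self]
      · have := Finset.mem_erase.2 ⟨hCC, hC⟩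
        rw [hne C this]
        exact hD C this
    · rw [← Finset.insert_erase h₀, Finset.set_biUnion_insert, Function.update_self,
        iUnion₂_congr hne, hU, union_sdiff_cancel hEB]
    · rwa [Function.update_self]

theorem exists_matching {s : Finset (Set W)} (hA : IsTrim Y p A) (hB : IsTrim Y p B)
    (hs : IsTrimDecomposition Y A s) (hwv : w ∈ A ↔ v ∈ B)
    (h : trimIdeal Y w = trimIdeal Y v) :
    ∃ D : Set W → Set W, (∀ C ∈ s, ∃ q, IsTrim Y q C ∧ IsTrim Y q (D C)) ∧
      (s : Set (Set W)).PairwiseDisjoint D ∧ ⋃ C ∈ s, D C = B ∧ ∀ C ∈ s, w ∈ C ↔ v ∈ D C := by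
  by_cases hw : w ∈ A
  · exact hY.exists_matching_of_mem hA hB hs hw (hwv.1 hw) h
  -- With `w` and `v` outside `A` and `B`, points of `Y p` serve as substitutes, having equal
  -- ideals.
  · obtain ⟨x, hxA, hx⟩ := hA.self_mem_typeOf
    obtain ⟨y, hyB, hy⟩ := hB.self_mem_typeOf
    obtain ⟨D, hD, hdisj, hU, -⟩ := hY.exists_matching_of_mem hA hB hs hxA hyB
      ((hY.trimIdeal_eq_of_mem hx).trans (hY.trimIdeal_eq_of_mem hy).symm)
    refine ⟨D, hD, hdisj, hU, fun C hC => ?_⟩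
    refine iff_of_false (fun h => hw (hs.subset hC h)) fun h => hw (hwv.2 ?_)
    rw [← hU]
    exact mem_biUnion hC h

end IsTrimPartition

/-- A finite collection of pairs of trim sets of equal type whose first components partition `A` and
whose second components partition `B`, such that `w` and `v` lie in corresponding sets. -/
structure IsMatching (Y : P → Set W) (w v : W) (A B : Set W) (S : Finset (Set W × Set W)) :
    Prop where
  trim : ∀ t ∈ S, ∃ p, IsTrim Y p t.1 ∧ IsTrim Y p t.2
  mem_iff : ∀ t ∈ S, w ∈ t.1 ↔ v ∈ t.2
  eq_fst : ∀ t ∈ S, ∀ t' ∈ S, ∀ x ∈ t.1, x ∈ t'.1 → t = t'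
  eq_snd : ∀ t ∈ S, ∀ t' ∈ S, ∀ x ∈ t.2, x ∈ t'.2 → t = t'
  cover_fst : ∀ x, x ∈ A ↔ ∃ t ∈ S, x ∈ t.1
  cover_snd : ∀ x, x ∈ B ↔ ∃ t ∈ S, x ∈ t.2

/-- `T` refines `S`. -/
def MatchingRefines {W : Type*} (S T : Finset (Set W × Set W)) : Prop :=
  ∀ b ∈ T, ∃ a ∈ S, b.1 ⊆ a.1 ∧ b.2 ⊆ a.2

open Classical in
theorem MatchingRefines.swap {W : Type*} {S T : Finset (Set W × Set W)} (h : MatchingRefines S T) :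
    MatchingRefines (S.image Prod.swap) (T.image Prod.swap) := by
  simp only [MatchingRefines, Finset.forall_mem_image, Finset.exists_mem_image]
  exact fun b hb => (h b hb).imp fun a ha => ⟨ha.1, ha.2.2, ha.2.1⟩

open Classical in
theorem IsMatching.swap {S : Finset (Set W × Set W)} (hS : IsMatching Y w v A B S) :
    IsMatching Y v w B A (S.image Prod.swap) where
  trim := by
    simp only [Finset.forall_mem_image]
    exact fun t ht => (hS.trim t ht).imp fun p h => h.symm
  mem_iff := by
    simp only [Finset.forall_mem_image]
    exact fun t ht => (hS.mem_iff t ht).symm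
  eq_fst := by
    simp only [Finset.forall_mem_image]
    exact fun t ht t' ht' x hx hx' => congrArg Prod.swap (hS.eq_snd t ht t' ht' x hx hx')
  eq_snd := by
    simp only [Finset.forall_mem_image]
    exact fun t ht t' ht' x hx hx' => congrArg Prod.swap (hS.eq_fst t ht t' ht' x hx hx')
  cover_fst x := by
    rw [hS.cover_snd]
    simp only [Finset.exists_mem_image, Prod.fst_swap]
  cover_snd x := by
    rw [hS.cover_fst]
    simp only [Finset.exists_mem_image, Prod.snd_swap]

open Classical in
-- The forth step: each first component is cut along `C` into trim sets, and the cut is copied in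
-- its partner. The back step follows by swapping.
theorem IsMatching.exists_refines_deciding_fst [T2Space W] (hY : IsTrimPartition Y)
    (h : trimIdeal Y w = trimIdeal Y v) {S : Finset (Set W × Set W)} (hS : IsMatching Y w v A B S)
    (hCc : IsCompact C) (hCo : IsOpen C) :
    ∃ T, IsMatching Y w v A B T ∧ MatchingRefines S T ∧ ∀ t ∈ T, t.1 ⊆ C ∨ Disjoint t.1 C := by
  have : ∀ t : S, ∃ (s : Finset (Set W)) (D : Set W → Set W), IsTrimDecomposition Y t.1.1 s ∧
      (∀ B ∈ s, B ⊆ C ∨ Disjoint B C) ∧ (∀ C ∈ s, ∃ q, IsTrim Y q C ∧ IsTrim Y q (D C)) ∧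
      (s : Set (Set W)).PairwiseDisjoint D ∧ ⋃ C ∈ s, D C = t.1.2 ∧
      ∀ C ∈ s, w ∈ C ↔ v ∈ D C := by
    rintro ⟨t, ht⟩
    obtain ⟨p, h₁, h₂⟩ := hS.trim t ht
    obtain ⟨s, hs, hsC⟩ := hY.exists_isTrimDecomposition_deciding h₁.isCompact h₁.isOpen hCc hCo
    obtain ⟨D, hD⟩ := hY.exists_matching h₁ h₂ hs (hS.mem_iff t ht) h
    exact ⟨s, D, hs, hsC, hD⟩
  choose s D hs hsC hD hdisj hU hmem using this
  have hsub : ∀ t : S, ∀ E ∈ s t, D t E ⊆ t.1.2 := fun t E hE =>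
    hU t ▸ subset_biUnion_of_mem (u := D t) hE
  let T : Finset (Set W × Set W) :=
    Finset.univ.biUnion fun t : S => (s t).image fun E => (E, D t E)
  have hT : ∀ b, b ∈ T ↔ ∃ t : S, ∃ E ∈ s t, (E, D t E) = b := fun b => by
    simp only [T, Finset.mem_biUnion, Finset.mem_univ, true_and, Finset.mem_image]
  refine ⟨T, ⟨?_, ?_, ?_, ?_, ?_, ?_⟩, ?_, ?_⟩
  · intro b hb
    obtain ⟨t, E, hE, rfl⟩ := (hT b).1 hb
    exact hD t E hE
  · intro b hb
    obtain ⟨t, E, hE, rfl⟩ := (hT b).1 hb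
    exact hmem t E hE
  · intro b hb b' hb' x hx hx'
    obtain ⟨t, E, hE, rfl⟩ := (hT b).1 hb
    obtain ⟨t', E', hE', rfl⟩ := (hT b').1 hb'
    obtain rfl : t = t' := Subtype.ext
      (hS.eq_fst _ t.2 _ t'.2 x ((hs t).subset hE hx) ((hs t').subset hE' hx'))
    obtain rfl : E = E' := by
      by_contra hne
      exact disjoint_left.1 ((hs t).disjoint hE hE' hne) hx hx'
    rfl
  · intro b hb b' hb' x hx hx'
    obtain ⟨t, E, hE, rfl⟩ := (hT b).1 hb
    obtain ⟨t', E', hE', rfl⟩ := (hT b').1 hb'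
    obtain rfl : t = t' := Subtype.ext
      (hS.eq_snd _ t.2 _ t'.2 x (hsub t E hE hx) (hsub t' E' hE' hx'))
    obtain rfl : E = E' := by
      by_contra hne
      exact disjoint_left.1 (hdisj t hE hE' hne) hx hx'
    rfl
  · intro x
    rw [hS.cover_fst]
    constructor
    · rintro ⟨t, ht, hx⟩
      rw [← (hs ⟨t, ht⟩).sUnion_eq] at hx
      obtain ⟨E, hE, hx⟩ := hx
      exact ⟨_, (hT _).2 ⟨⟨t, ht⟩, E, hE, rfl⟩, hx⟩
    · rintro ⟨b, hb, hx⟩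
      obtain ⟨t, E, hE, rfl⟩ := (hT b).1 hb
      exact ⟨t, t.2, (hs t).subset hE hx⟩
  · intro x
    rw [hS.cover_snd]
    constructor
    · rintro ⟨t, ht, hx⟩
      rw [← hU ⟨t, ht⟩] at hx
      obtain ⟨E, hE, hx⟩ := mem_iUnion₂.1 hx
      exact ⟨_, (hT _).2 ⟨⟨t, ht⟩, E, hE, rfl⟩, hx⟩
    · rintro ⟨b, hb, hx⟩
      obtain ⟨t, E, hE, rfl⟩ := (hT b).1 hb
      exact ⟨t, t.2, hsub t E hE hx⟩
  · intro b hb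
    obtain ⟨t, E, hE, rfl⟩ := (hT b).1 hb
    exact ⟨t, t.2, (hs t).subset hE, hsub t E hE⟩
  · intro b hb
    obtain ⟨t, E, hE, rfl⟩ := (hT b).1 hb
    exact hsC t E hE

open Classical in
theorem IsMatching.exists_refines_deciding_snd [T2Space W] (hY : IsTrimPartition Y)
    (h : trimIdeal Y w = trimIdeal Y v) {S : Finset (Set W × Set W)} (hS : IsMatching Y w v A B S)
    (hCc : IsCompact C) (hCo : IsOpen C) :
    ∃ T, IsMatching Y w v A B T ∧ MatchingRefines S T ∧ ∀ t ∈ T, t.2 ⊆ C ∨ Disjoint t.2 C := by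
  obtain ⟨T, hT, hST, hTC⟩ := hS.swap.exists_refines_deciding_fst hY h.symm hCc hCo
  refine ⟨_, hT.swap, ?_, ?_⟩
  · simp only [MatchingRefines, Finset.forall_mem_image]
    intro b hb
    obtain ⟨a, ha, h₁, h₂⟩ := hST b hb
    obtain ⟨c, hc, rfl⟩ := Finset.mem_image.1 ha
    exact ⟨c, hc, h₂, h₁⟩
  · simpa only [Finset.forall_mem_image, Prod.snd_swap] using hTC

end Matching

/-! ### From a directed system of paired sets to an involutive homeomorphism. -/

section Pairing

variable {W : Type*} [TopologicalSpace W] {A B : Set W} {R : Set (Set W × Set W)}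

/-- The first components of the pairs in `R` are compact open sets that form a base for the topology
of `A`, and the second components shrink along with the first. -/
structure IsHalfPairing (A : Set W) (R : Set (Set W × Set W)) : Prop where
  subset : ∀ t ∈ R, t.1 ⊆ A
  isCompact : ∀ t ∈ R, IsCompact t.1
  isOpen : ∀ t ∈ R, IsOpen t.1
  nonempty : ∀ t ∈ R, t.1.Nonempty
  directed : ∀ t ∈ R, ∀ t' ∈ R, ∀ x ∈ t.1, x ∈ t'.1 →
    ∃ t'' ∈ R, x ∈ t''.1 ∧ t''.1 ⊆ t.1 ∩ t'.1 ∧ t''.2 ⊆ t.2 ∩ t'.2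
  base : ∀ x ∈ A, ∀ U ∈ 𝓝 x, ∃ t ∈ R, x ∈ t.1 ∧ t.1 ⊆ U

theorem IsHalfPairing.continuousAt (hA : IsHalfPairing A R)
    (hB : IsHalfPairing B (Prod.swap ⁻¹' R)) {h : W → W} (hinv : ∀ x, h (h x) = x)
    (h₁ : ∀ t ∈ R, ∀ x ∈ t.1, h x ∈ t.2) (h₂ : ∀ t ∈ R, ∀ x ∈ t.2, h x ∈ t.1) {x : W}
    (hx : x ∈ A) : ContinuousAt h x := by
  obtain ⟨t, ht, hxt, -⟩ := hA.base x hx univ univ_mem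
  intro U hU
  obtain ⟨t', ht', hxt', hU'⟩ := hB.base (h x) (hB.subset t.swap ht (h₁ t ht x hxt)) U hU
  have hx' : x ∈ t'.2 := hinv x ▸ h₂ t'.swap ht' (h x) hxt'
  refine mem_map.2 (mem_of_superset ((hA.isOpen t'.swap ht').mem_nhds hx') fun z hz => ?_)
  exact hU' (h₁ t'.swap ht' z hz)

variable [T2Space W]

/-- The partners of the sets around `x` form a directed family of non-empty compact sets. -/
theorem IsHalfPairing.exists_partner (hA : IsHalfPairing A R)
    (hB : IsHalfPairing B (Prod.swap ⁻¹' R)) {x : W} (hx : x ∈ A) :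
    ∃ y, ∀ t ∈ R, x ∈ t.1 → y ∈ t.2 := by
  have : Nonempty (Prod.snd '' {t ∈ R | x ∈ t.1}) := by
    obtain ⟨t, ht, hxt, -⟩ := hA.base x hx univ univ_mem
    exact ⟨_, t, ⟨ht, hxt⟩, rfl⟩
  obtain ⟨y, hy⟩ := IsCompact.nonempty_sInter_of_directed_nonempty_isCompact_isClosed
    (S := Prod.snd '' {t ∈ R | x ∈ t.1}) (by
      rintro _ ⟨t, ⟨ht, hxt⟩, rfl⟩ _ ⟨t', ⟨ht', hxt'⟩, rfl⟩
      obtain ⟨t'', ht'', hx'', -, h⟩ := hA.directed t ht t' ht' x hxt hxt'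
      exact ⟨_, ⟨t'', ⟨ht'', hx''⟩, rfl⟩, h.trans inter_subset_left, h.trans inter_subset_right⟩)
    (by
      rintro _ ⟨t, ⟨ht, -⟩, rfl⟩
      exact hB.nonempty t.swap ht)
    (by
      rintro _ ⟨t, ⟨ht, -⟩, rfl⟩
      exact hB.isCompact t.swap ht)
    (by
      rintro _ ⟨t, ⟨ht, -⟩, rfl⟩
      exact (hB.isCompact t.swap ht).isClosed)
  exact ⟨y, fun t ht hxt => hy _ ⟨t, ⟨ht, hxt⟩, rfl⟩⟩

open Classical in
theorem IsHalfPairing.exists_homeomorph (hA : IsHalfPairing A R)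
    (hB : IsHalfPairing B (Prod.swap ⁻¹' R)) (hAB : Disjoint A B) (hAc : IsClosed A)
    (hBc : IsClosed B) :
    ∃ h : W ≃ₜ W, (∀ x, h (h x) = x) ∧ (∀ t ∈ R, ∀ x ∈ t.1, h x ∈ t.2) ∧
      (∀ t ∈ R, ∀ x ∈ t.2, h x ∈ t.1) ∧ ∀ x ∉ A ∪ B, h x = x := by
  choose f hf using fun x : A => hA.exists_partner hB x.2
  choose g hg using fun x : B => hB.exists_partner (B := A) (R := Prod.swap ⁻¹' R) hA x.2
  let h : W → W := fun x => if hx : x ∈ A then f ⟨x, hx⟩ else if hx : x ∈ B then g ⟨x, hx⟩ else x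
  have h₁ : ∀ t ∈ R, ∀ x ∈ t.1, h x ∈ t.2 := fun t ht x hx => by
    have hxA := hA.subset t ht hx
    simp only [h, dif_pos hxA]
    exact hf ⟨x, hxA⟩ t ht hx
  have h₂ : ∀ t ∈ R, ∀ x ∈ t.2, h x ∈ t.1 := fun t ht x hx => by
    have hxB := hB.subset t.swap ht hx
    simp only [h, dif_pos hxB, dif_neg (disjoint_right.1 hAB hxB)]
    exact hg ⟨x, hxB⟩ t.swap ht hx
  have h₃ : ∀ x ∉ A ∪ B, h x = x := fun x hx => by
    simp only [h, dif_neg fun hA => hx (Or.inl hA), dif_neg fun hB => hx (Or.inr hB)]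
  -- For `x` in `A` or `B`, `h (h x)` lies in every basic set around `x`, so the Hausdorff property
  -- identifies the two.
  have hinv : ∀ x, h (h x) = x := by
    intro x
    by_contra hne
    have hU : {z | z ≠ h (h x)} ∈ 𝓝 x := isOpen_ne.mem_nhds (Ne.symm hne)
    by_cases hxA : x ∈ A
    · obtain ⟨t, ht, hxt, hU⟩ := hA.base x hxA _ hU
      exact hU (h₂ t ht _ (h₁ t ht x hxt)) rfl
    by_cases hxB : x ∈ B
    · obtain ⟨t, ht, hxt, hU⟩ := hB.base x hxB _ hU
      exact hU (h₁ t.swap ht _ (h₂ t.swap ht x hxt)) rfl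
    have hx := h₃ x fun h => h.elim hxA hxB
    exact hne (by rw [hx, hx])
  have hcont : Continuous h := continuous_iff_continuousAt.2 fun x => by
    by_cases hxA : x ∈ A
    · exact hA.continuousAt hB hinv h₁ h₂ hxA
    by_cases hxB : x ∈ B
    · exact hB.continuousAt (B := A) hA hinv (fun t => h₂ t.swap) (fun t => h₁ t.swap) hxB
    refine continuousAt_id.congr ?_
    filter_upwards [(hAc.union hBc).isOpen_compl.mem_nhds fun h => h.elim hxA hxB] with z hz
    exact (h₃ z hz).symm
  exact ⟨⟨⟨h, h, hinv, hinv⟩, hcont, hcont⟩, hinv, h₁, h₂, h₃⟩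

end Pairing

/-! ### Orbits of the homeomorphisms preserving the partition. -/

section Homogeneity

variable {W : Type*} [TopologicalSpace W] {P : Type*} [POSystem P] {Y : P → Set W}
  {p q : P} {A B C : Set W} {v w : W}

theorem IsPHomeo.trimIdeal_subset {f : W ≃ₜ W} (hf : IsPHomeo Y f) (w : W) :
    trimIdeal Y w ⊆ trimIdeal Y (f w) := by
  rintro p ⟨A, hA, hw⟩
  have hpre : ∀ q, f ⁻¹' (Y q) = Y q := fun q => by
    rw [← hf q, preimage_image_eq _ f.injective, hf q]
  have himg : ∀ q, f '' A ∩ Y q = f '' (A ∩ Y q) := fun q => by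
    rw [← hf q, ← image_inter f.injective, hf q]
  refine ⟨f '' A, ⟨hA.isCompact.image f.continuous, f.isOpenMap A hA.isOpen, ?_, fun hp => ?_⟩,
    mem_image_of_mem f hw⟩
  · rw [← hA.type_eq]
    ext q
    rw [typeOf, mem_ofPred, himg, image_nonempty]
    rfl
  · rw [himg, f.injective.encard_image, hA.card_eq hp]

/-- The matchings, preordered by refinement. -/
def Matching (Y : P → Set W) (w v : W) (A B : Set W) : Type _ :=
  {S : Finset (Set W × Set W) // IsMatching Y w v A B S}

instance : Preorder (Matching Y w v A B) where
  le S T := MatchingRefines S.1 T.1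
  le_refl _ b hb := ⟨b, hb, Subset.rfl, Subset.rfl⟩
  le_trans _ _ _ hST hTU c hc := by
    obtain ⟨b, hb, h₁, h₂⟩ := hTU c hc
    obtain ⟨a, ha, h₁', h₂'⟩ := hST b hb
    exact ⟨a, ha, h₁.trans h₁', h₂.trans h₂'⟩

theorem isHalfPairing_of_isMatching (hY : IsTrimPartition Y)
    {G : Set (Finset (Set W × Set W))} {R : Set (Set W × Set W)}
    (hR : ∀ t, t ∈ R ↔ ∃ S ∈ G, t ∈ S) (hG : ∀ S ∈ G, IsMatching Y w v A B S)
    (hdir : ∀ S ∈ G, ∀ S' ∈ G, ∃ T ∈ G, MatchingRefines S T ∧ MatchingRefines S' T)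
    (hdec : ∀ C, IsCompact C → IsOpen C → ∃ S ∈ G, ∀ t ∈ S, t.1 ⊆ C ∨ Disjoint t.1 C) :
    IsHalfPairing A R where
  subset t ht x hx := by
    obtain ⟨S, hS, ht⟩ := (hR t).1 ht
    exact ((hG S hS).cover_fst x).2 ⟨t, ht, hx⟩
  isCompact t ht := by
    obtain ⟨S, hS, ht⟩ := (hR t).1 ht
    obtain ⟨p, hp, -⟩ := (hG S hS).trim t ht
    exact hp.isCompact
  isOpen t ht := by
    obtain ⟨S, hS, ht⟩ := (hR t).1 ht
    obtain ⟨p, hp, -⟩ := (hG S hS).trim t ht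
    exact hp.isOpen
  nonempty t ht := by
    obtain ⟨S, hS, ht⟩ := (hR t).1 ht
    obtain ⟨p, hp, -⟩ := (hG S hS).trim t ht
    exact hp.self_mem_typeOf.mono inter_subset_left
  directed t ht t' ht' x hx hx' := by
    obtain ⟨S, hS, ht⟩ := (hR t).1 ht
    obtain ⟨S', hS', ht'⟩ := (hR t').1 ht'
    obtain ⟨T, hT, hST, hST'⟩ := hdir S hS S' hS'
    obtain ⟨b, hb, hxb⟩ := ((hG T hT).cover_fst x).1 (((hG S hS).cover_fst x).2 ⟨t, ht, hx⟩)
    obtain ⟨a, ha, h₁, h₂⟩ := hST b hb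
    obtain ⟨a', ha', h₁', h₂'⟩ := hST' b hb
    obtain rfl := (hG S hS).eq_fst a ha t ht x (h₁ hxb) hx
    obtain rfl := (hG S' hS').eq_fst a' ha' t' ht' x (h₁' hxb) hx'
    exact ⟨b, (hR b).2 ⟨T, hT, hb⟩, hxb, subset_inter h₁ h₁', subset_inter h₂ h₂'⟩
  base x hx U hU := by
    obtain ⟨p, E, hE, hxE, hEU⟩ := hY.trimBase x U hU
    obtain ⟨S, hS, hSE⟩ := hdec E hE.isCompact hE.isOpen
    obtain ⟨t, ht, hxt⟩ := ((hG S hS).cover_fst x).1 hx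
    refine ⟨t, (hR t).2 ⟨S, hS, ht⟩, hxt, ?_⟩
    rcases hSE t ht with h | h
    · exact h.trans hEU
    · exact absurd hxE (disjoint_left.1 h hxt)

/-- By T2 it suffices to find arbitrarily small `p`-trim sets around `h x`. A pair whose first
component contains `x` and lies in a `p`-trim set has type exactly `p`, and its second component
serves. -/
theorem IsHalfPairing.mem_of_mem (hY : IsTrimPartition Y) {R : Set (Set W × Set W)}
    (hA : IsHalfPairing A R) (hB : IsHalfPairing B (Prod.swap ⁻¹' R))
    (htrim : ∀ t ∈ R, ∃ p, IsTrim Y p t.1 ∧ IsTrim Y p t.2) {h : W → W}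
    (hinv : ∀ x, h (h x) = x) (h₁ : ∀ t ∈ R, ∀ x ∈ t.1, h x ∈ t.2)
    (h₂ : ∀ t ∈ R, ∀ x ∈ t.2, h x ∈ t.1) {x : W} (hx : x ∈ A) (hxp : x ∈ Y p) : h x ∈ Y p := by
  refine hY.full p (hY.trimTypes_eq ▸ mem_univ p) _ fun U hU => ?_
  obtain ⟨E, hE, hxE, -⟩ := hY.exists_isTrim_subset hxp univ_mem
  obtain ⟨t, ht, hxt, htE⟩ := hA.base x hx E (hE.mem_nhds hxE)
  obtain ⟨t', ht', hxt', htU⟩ := hB.base (h x) (hB.subset t.swap ht (h₁ t ht x hxt)) U hU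
  obtain ⟨b, hb, hxb, hb₁, hb₂⟩ := hA.directed t ht t'.swap ht' x hxt
    (hinv x ▸ h₂ t'.swap ht' (h x) hxt')
  obtain ⟨q, hq₁, hq₂⟩ := htrim b hb
  have hqp : q ≤ p := hq₁.le hxb hxp
  have hpq : p ≤ q := hE.mem_typeOf_iff.1
    (typeOf_mono (fun z hz => htE (hb₁ hz).1) hq₁.self_mem_typeOf)
  obtain rfl := le_antisymm hqp hpq
  exact ⟨b.2, hq₂, h₁ b hb x hxb, fun z hz => htU (hb₂ hz).2⟩

namespace IsTrimPartition

variable [T2Space W] (hY : IsTrimPartition Y)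
include hY

theorem exists_disjoint_isTrim (h : trimIdeal Y w = trimIdeal Y v) (hne : w ≠ v) :
    ∃ p A B, IsTrim Y p A ∧ IsTrim Y p B ∧ w ∈ A ∧ v ∈ B ∧ Disjoint A B := by
  obtain ⟨U, V, hU, hV, hwU, hvV, hUV⟩ := t2_separation hne
  obtain ⟨q, B, hB, hvB, hBV⟩ := hY.trimBase v V (hV.mem_nhds hvV)
  obtain ⟨E, hE, hwE⟩ : q ∈ trimIdeal Y w := h ▸ ⟨B, hB, hvB⟩
  obtain ⟨p, A, hA, hwA, hAU⟩ := hY.trimBase w (U ∩ E)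
    (inter_mem (hU.mem_nhds hwU) (hE.mem_nhds hwE))
  have hqp : q ≤ p := hE.mem_typeOf_iff.1
    (typeOf_mono (hAU.trans inter_subset_right) hA.self_mem_typeOf)
  -- `A` was shrunk into a `q`-trim set so that `q ≤ p`; thus `B` meets `Y p` and contains a
  -- `p`-trim neighbourhood of `v`.
  have hpv : p ∈ trimIdeal Y v := h ▸ ⟨A, hA, hwA⟩
  obtain ⟨B', hB', hvB', hBB'⟩ := hY.exists_isTrim_subset_of_mem_trimIdeal hpv hB.isOpen hvB
    (hB.mem_typeOf_iff.2 hqp)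
  exact ⟨p, A, B', hA, hB', hwA, hvB',
    hUV.mono (hAU.trans inter_subset_left) (hBB'.trans hBV)⟩

open Classical in
theorem exists_isPHomeo [SecondCountableTopology W] (h : trimIdeal Y w = trimIdeal Y v) :
    ∃ f : W ≃ₜ W, IsPHomeo Y f ∧ f w = v := by
  rcases eq_or_ne w v with rfl | hne
  · exact ⟨Homeomorph.refl W, fun p => image_id _, rfl⟩
  obtain ⟨p, A, B, hA, hB, hwA, hvB, hAB⟩ := hY.exists_disjoint_isTrim h hne
  let M := Matching Y w v A B
  have := (countable_isCompact_isOpen W).to_subtype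
  let K := {C : Set W | IsCompact C ∧ IsOpen C}
  have : Encodable (K ⊕ K) := Encodable.ofCountable _
  -- Deciding every compact open set on both sides makes the components of the generic matchings
  -- bases of `A` and of `B`.
  let D : K ⊕ K → Order.Cofinal M := Sum.elim
    (fun C => ⟨{S | ∀ t ∈ S.1, t.1 ⊆ C.1 ∨ Disjoint t.1 C.1}, fun S => by
      obtain ⟨T, hT, hST, hTC⟩ := S.2.exists_refines_deciding_fst hY h C.2.1 C.2.2
      exact ⟨⟨T, hT⟩, hTC, hST⟩⟩)
    (fun C => ⟨{S | ∀ t ∈ S.1, t.2 ⊆ C.1 ∨ Disjoint t.2 C.1}, fun S => by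
      obtain ⟨T, hT, hST, hTC⟩ := S.2.exists_refines_deciding_snd hY h C.2.1 C.2.2
      exact ⟨⟨T, hT⟩, hTC, hST⟩⟩)
  let S₀ : M := ⟨{(A, B)}, by
    constructor <;> simp [hwA, hvB]
    exact ⟨p, hA, hB⟩⟩
  let G : Set (Finset (Set W × Set W)) := Subtype.val '' (Order.idealOfCofinals S₀ D : Set M)
  let R : Set (Set W × Set W) := {t | ∃ S ∈ G, t ∈ S}
  have hG : ∀ S ∈ G, IsMatching Y w v A B S := by
    rintro _ ⟨S, -, rfl⟩
    exact S.2
  have hdir : ∀ S ∈ G, ∀ S' ∈ G, ∃ T ∈ G, MatchingRefines S T ∧ MatchingRefines S' T := by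
    rintro _ ⟨S, hS, rfl⟩ _ ⟨S', hS', rfl⟩
    obtain ⟨T, hT, h₁, h₂⟩ := (Order.idealOfCofinals S₀ D).directed S hS S' hS'
    exact ⟨_, ⟨T, hT, rfl⟩, h₁, h₂⟩
  have hA' : IsHalfPairing A R := by
    refine isHalfPairing_of_isMatching hY (fun t => Iff.rfl) hG hdir fun C hCc hCo => ?_
    obtain ⟨S, hSD, hSG⟩ := Order.cofinal_meets_idealOfCofinals S₀ D (Sum.inl ⟨C, hCc, hCo⟩)
    exact ⟨_, ⟨S, hSG, rfl⟩, hSD⟩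
  have hB' : IsHalfPairing B (Prod.swap ⁻¹' R) := by
    refine isHalfPairing_of_isMatching (w := v) (v := w) (B := A) hY
      (G := Finset.image Prod.swap '' G) (fun t => ?_) ?_ ?_ fun C hCc hCo => ?_
    · constructor
      · rintro ⟨S, hS, ht⟩
        exact ⟨_, ⟨S, hS, rfl⟩, Finset.mem_image.2 ⟨_, ht, Prod.swap_swap t⟩⟩
      · rintro ⟨_, ⟨S, hS, rfl⟩, ht⟩
        obtain ⟨t, ht, rfl⟩ := Finset.mem_image.1 ht
        exact ⟨S, hS, by rwa [Prod.swap_swap]⟩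
    · rintro _ ⟨S, hS, rfl⟩
      exact (hG S hS).swap
    · rintro _ ⟨S, hS, rfl⟩ _ ⟨S', hS', rfl⟩
      obtain ⟨T, hT, h₁, h₂⟩ := hdir S hS S' hS'
      exact ⟨_, ⟨T, hT, rfl⟩, h₁.swap, h₂.swap⟩
    · obtain ⟨S, hSD, hSG⟩ := Order.cofinal_meets_idealOfCofinals S₀ D (Sum.inr ⟨C, hCc, hCo⟩)
      refine ⟨_, ⟨_, ⟨S, hSG, rfl⟩, rfl⟩, ?_⟩
      simp only [Finset.forall_mem_image]
      exact hSD
  have htrim : ∀ t ∈ R, ∃ p, IsTrim Y p t.1 ∧ IsTrim Y p t.2 := by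
    rintro t ⟨S, hS, ht⟩
    exact (hG S hS).trim t ht
  obtain ⟨f, hinv, h₁, h₂, h₃⟩ := hA'.exists_homeomorph hB' hAB hA.isCompact.isClosed
    hB.isCompact.isClosed
  have hf : ∀ p, ∀ x ∈ Y p, f x ∈ Y p := by
    intro p x hx
    by_cases hxA : x ∈ A
    · exact hA'.mem_of_mem hY hB' htrim hinv h₁ h₂ hxA hx
    by_cases hxB : x ∈ B
    · exact hB'.mem_of_mem hY (B := A) (R := Prod.swap ⁻¹' R) hA'
        (fun t ht => (htrim t.swap ht).imp fun p h => h.symm) hinv (fun t => h₂ t.swap)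
        (fun t => h₁ t.swap) hxB hx
    · rwa [h₃ x fun h => h.elim hxA hxB]
  refine ⟨f, fun p => Subset.antisymm (image_subset_iff.2 (hf p)) fun x hx =>
    ⟨f x, hf p x hx, hinv x⟩, ?_⟩
  -- A pair separating `v` from `f w` would still match `w` with `v`, so its component around `v`
  -- would contain `f w`.
  by_contra hfw
  obtain ⟨t, ⟨S, hS, ht⟩, hvt, hU⟩ := hB'.base v hvB _ (isOpen_ne.mem_nhds (Ne.symm hfw))
  exact hU (h₁ t.swap ⟨S, hS, ht⟩ w (((hG S hS).mem_iff _ ht).2 hvt)) rfl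

theorem range_idealCompletion [SecondCountableTopology W] :
    range (idealCompletion Y) = pHomeoOrbits Y := by
  have horbit : ∀ (J : Order.Ideal P) (w : W), w ∈ idealCompletion Y J →
      idealCompletion Y J = {v | ∃ f : W ≃ₜ W, IsPHomeo Y f ∧ f w = v} := by
    intro J w hw
    ext v
    constructor
    · exact fun hv => hY.exists_isPHomeo (hw.trans hv.symm)
    · rintro ⟨f, hf, rfl⟩
      refine (Subset.antisymm (hf.trimIdeal_subset w) ?_).symm.trans hw
      have hf' : IsPHomeo Y f.symm := fun p => by
        conv_lhs => rw [← hf p]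
        rw [← image_comp]
        simp
      simpa using hf'.trimIdeal_subset (f w)
  ext O
  constructor
  · rintro ⟨J, rfl⟩
    obtain ⟨w, hw⟩ := hY.isPPartition_idealCompletion.nonempty J
    exact ⟨w, horbit J w hw⟩
  · rintro ⟨w, rfl⟩
    obtain ⟨J, hw⟩ := hY.exists_mem_idealCompletion w
    exact ⟨J, horbit J w hw⟩

end IsTrimPartition

end Homogeneity

end PrimitiveSpace

theorem mainTheorem3 {W : Type*} [TopologicalSpace W] [T2Space W] [LocallyCompactSpace W]
    [TotallyDisconnectedSpace W] [SecondCountableTopology W] (hW : IsPrimitive W)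
    {P : Type*} [POSystem P] (Y : P → Set W) (hY : IsTrimPartition Y) :
    IsRankPartition (idealCompletion Y) ∧
    -- the clean interior of `id(Y)` is `Y`
    (IsSemiTrimPartition (idealCompletion Y) ∧
      ∃ e : P ≃ trimTypes (idealCompletion Y),
        (∀ p, (e p : Order.Ideal P) = Order.Ideal.principal p) ∧
        SamePartition Y (cleanInterior (idealCompletion Y)) e) ∧
    -- `id(Y)` regularly extends `Y`
    IsRegularExtension (idealCompletion Y) Y Order.Ideal.principal ∧
    -- the elements of `id(Y)` are the orbits of `P`-homeomorphisms
    range (idealCompletion Y) = pHomeoOrbits Y ∧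
    -- `id(Y)` regularly refines every complete semi-trim partition with clean interior `Y`
    (∀ (Q : Type*) [POSystem Q] (V : Q → Set W), IsSemiTrimPartition V → IsCompletePartition V →
      ∀ e : P ≃ trimTypes V, SamePartition Y (cleanInterior V) e →
        ∃ β : Order.Ideal P → Q,
          (∀ J : Order.Ideal P, IsLUB ((fun p => (e p : Q)) '' (J : Set P)) (β J)) ∧
          RegularlyRefines (idealCompletion Y) V β) ∧
    -- regular refinements lift to ideal completions
    (∀ (Q : Type*) [POSystem Q] (V : Q → Set W), IsTrimPartition V →
      ∀ α : Q → P, Function.Surjective α → IsMorphism α → RegularlyRefines V Y α →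
        ∃ idα : Order.Ideal Q → Order.Ideal P,
          (∀ J : Order.Ideal Q, (idα J : Set P) = {p | ∃ q ∈ J, p ≤ α q}) ∧
          RegularlyRefines (idealCompletion V) (idealCompletion Y) idα) := by
  refine ⟨hY.isRankPartition_idealCompletion, ⟨hY.isSemiTrimPartition_idealCompletion,
    hY.exists_equiv_cleanInterior_idealCompletion⟩, hY.isRegularExtension_idealCompletion,
    hY.range_idealCompletion, ?_, ?_⟩
  · intro Q _ V hV hc e he
    exact hY.exists_regularlyRefines_of_isCompletePartition hV hc e he
  · intro Q _ V hV α _ hα hr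
    exact exists_regularlyRefines_idealCompletion hY hV hα.monotone hr
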